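/- For $M\ge 1$ let $\Omega_M=\{1,2,3\}^M$, and for $\sigma\in\Omega_M$ let $s_c(\sigma)=\frac1M\,|\{l:\sigma_l=c\}|$, $c=1,2,3$. Let $\mu_M$ be the three-colour mean-field Potts distribution at the critical parameter $\tilde\beta_c=2\log 2$, $$\mu_M(\sigma)=\frac{\exp\big(M\tilde\beta_c\,(s_1(\sigma)^2+s_2(\sigma)^2+s_3(\sigma)^2)\big)}{\sum_{\tau\in\Omega_M}\exp\big(M\tilde\beta_c\,(s_1(\tau)^2+s_2(\tau)^2+s_3(\tau)^2)\big)},$$ and let $P$ be the Markov kernel of its Glauber dynamics: in each step a uniformly chosen spin is resampled from its conditional distribution under $\mu_M$ given the other spins. Let $C_1=(\frac23,\frac16,\frac16)$, $C_2=(\frac16,\frac23,\frac16)$, $C_3=(\frac16,\frac16,\frac23)$, $C_4=(\frac13,\frac13,\frac13)$ and $\rho=10^{-6}$. The modes are $F_M^{(i)}=\{\sigma\in\Omega_M: s_i(\sigma)>\frac12\}$ for $i=1,2,3$ and $F_M^{(4)}=\Omega_M\setminus(F_M^{(1)}\cup F_M^{(2)}\cup F_M^{(3)})$; the inner regions are $$\mathcal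 I_M^{(i)}=\Big\{\sigma\in\Omega_M: -\frac{\rho}{4}\le s_c(\sigma)-C_{i,c}\le\frac{\rho}{2}\ \text{ for } c=1,2,3\Big\},\qquad 1\le i\le 4.$$ Let $\mu_M^{(i)}(\sigma)=\mu_M(\sigma)\mathbf 1[\sigma\in F_M^{(i)}]/\mu_M(F_M^{(i)})$ be the restriction of $\mu_M$ to $F_M^{(i)}$, and let $d_{\mathrm{TV}}(\eta_1,\eta_2)=\frac12\sup_{f:\Omega_M\to[-1,1]}|\eta_1(f)-\eta_2(f)|$. Proposition. There are absolute constants $C,C'>0$ and $M_0$ such that for every integer $M\ge M_0$, every integer $k\ge 330\,M\log M$, every $1\le i\le 4$ and every $\sigma\in\mathcal I_M^{(i)}$, $$d_{\mathrm{TV}}\big(P^k(\sigma,\cdot),\mu_M^{(i)}\big)\le\frac{C}{M^2}+3k^2\exp(-C'M).$$ -/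

import Mathlib

open scoped BigOperators

noncomputable section

namespace MeanFieldPotts

/-- Configurations of `M` spins, each with one of three colours. -/
abbrev Config (M : ℕ) : Type := Fin M → Fin 3

/-- The ratio `s_c(σ)` of spins of colour `c` in the configuration `σ`. -/
def ratio {M : ℕ} (σ : Config M) (c : Fin 3) : ℝ :=
  ((Finset.univ.filter (fun l : Fin M => σ l = c)).card : ℝ) / (M : ℝ)

/-- The unnormalised Gibbs weight `exp (M β (s₁² + s₂² + s₃²))`. -/
def weight (β : ℝ) {M : ℕ} (σ : Config M) : ℝ :=
  Real.exp ((M : ℝ) * β * ∑ c : Fin 3, ratio σ c ^ 2)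

/-- The three-colour mean-field Potts distribution on `M` spins with parameter `β`
(its probability mass function). -/
def gibbs (β : ℝ) (M : ℕ) (σ : Config M) : ℝ :=
  weight β σ / ∑ τ : Config M, weight β τ

/-- The critical parameter `2 log 2`. -/
def criticalBeta : ℝ := 2 * Real.log 2

/-- The conditional probability, under the probability mass function `μ`, that the spin at `v` has
colour `c`, given that all the other spins are as in `σ`. -/
def condProb {M : ℕ} (μ : Config M → ℝ) (σ : Config M) (v : Fin M) (c : Fin 3) : ℝ :=
  μ (Function.update σ v c) / ∑ b : Fin 3, μ (Function.update σ v b)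

/-- The transition matrix of the Glauber dynamics for `μ`: a uniformly chosen spin is resampled
from its conditional distribution under `μ` given the other spins. -/
def glauber {M : ℕ} (μ : Config M → ℝ) : Matrix (Config M) (Config M) ℝ :=
  Matrix.of fun σ τ =>
    (1 / (M : ℝ)) * ∑ v : Fin M, ∑ c : Fin 3,
      if Function.update σ v c = τ then condProb μ σ v c else 0

/-- The four centres (barycentric coordinates). -/
def centre : Fin 4 → Fin 3 → ℝ :=
  ![![2 / 3, 1 / 6, 1 / 6], ![1 / 6, 2 / 3, 1 / 6], ![1 / 6, 1 / 6, 2 / 3],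
    ![1 / 3, 1 / 3, 1 / 3]]

/-- Configurations in which colour `c` has a strict majority. -/
def majority (M : ℕ) (c : Fin 3) : Set (Config M) := {σ | 1 / 2 < ratio σ c}

/-- The four modes: strict majority of one of the three colours, and all the other
configurations. -/
def mode (M : ℕ) : Fin 4 → Set (Config M) :=
  ![majority M 0, majority M 1, majority M 2,
    (majority M 0 ∪ majority M 1 ∪ majority M 2)ᶜ]

/-- The size parameter of the inner regions. -/
def rho : ℝ := 1 / 10 ^ 6

/-- The inner region of the mode `i`: the colour ratios lie in a small triangle around the `i`-th
centre. -/
def innerRegion (M : ℕ) (i : Fin 4) : Set (Config M) :=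
  {σ | ∀ c : Fin 3, -(rho / 4) ≤ ratio σ c - centre i c ∧ ratio σ c - centre i c ≤ rho / 2}

open scoped Classical in
/-- The restriction of the probability mass function `μ` to the set `F`, renormalised. -/
def restrictTo {α : Type*} [Fintype α] (μ : α → ℝ) (F : Set α) (x : α) : ℝ :=
  (if x ∈ F then μ x else 0) / ∑ y : α, if y ∈ F then μ y else 0

/-- Total variation distance of two mass functions on a finite set:
half of the supremum of `|p(f) - q(f)|` over all functions `f` with values in `[-1,1]`. -/
def dTV {α : Type*} [Fintype α] (p q : α → ℝ) : ℝ :=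
  (1 / 2) * ⨆ f : {f : α → ℝ // ∀ x, f x ∈ Set.Icc (-1 : ℝ) 1},
    |∑ x, p x * f.1 x - ∑ x, q x * f.1 x|

end MeanFieldPotts

end

/-! Statics. Since `∑ c, (ratio σ c - y c) ^ 2 ≥ 0`, linearising the quadratic energy at any `y`
gives a product weight `linWeight y` below the Gibbs weight, with equality at `y = ratio σ` and
total mass `exp (M * dualEnergy y)`. Summing over the at most `(M + 1) ^ 3` possible ratio vectors
bounds the weight of a set of configurations by the largest dual energy on it; the product weight at
a centre gives a lower bound of the same exponential order. At `2 log 2` the dual energy on the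
plane `∑ c, y c = 1` is maximal exactly at the four centres (`dualEnergy_lt`, `dualEnergy_centre`).
By compactness each mode therefore concentrates exponentially on a triangle around its own centre,
the `core` (`exists_concentration`).

Dynamics. The conditional law of a spin is the softmax of the ratios of the other spins. Each centre
is a fixed point of softmax, and nearby one changed spin moves a colour probability by about `(4 log
2 / 3) / M` at most, with `4 log 2 / 3 < 0.93`. Freezing the update probabilities outside a small
box makes this contraction global: one step of the clipped dynamics multiplies the oscillation of a
test function by at most `1 - 0.07 / M` (`HasOscillation.resample_clippedProb`).

Transfer. The two dynamics agree on the core. Softmax pushes the ratios back inside it, and an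
exponential Lyapunov function makes an exit exponentially unlikely (`resample_lyap_le`,
`abs_iterate_sub_iterate_le`). By reversibility and concentration the restricted Gibbs measure is
almost stationary for the clipped dynamics (`abs_sum_mul_iterate_clipped_sub_le`). With `P` and `Q`
the true and the clipped operator and `ν` the restricted measure, the result follows from splitting
`P^k f σ - ν f` into `(P^k - Q^k) f σ`, `Q^k f σ - ν (Q^k f)` and `ν (Q^k f) - ν f`. -/

open scoped BigOperators

noncomputable section

namespace MeanFieldPotts

/-! ### The dual free energy and its four maximisers -/

/-- The moment generating function of the uniform law on `{-1, 0, 1}` is sub-Gaussian with the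
variance of that law. -/
lemma one_add_two_cosh_le (z : ℝ) : (1 + 2 * Real.cosh z) / 3 ≤ Real.exp (z ^ 2 / 3) := by
  have h1 : HasSum (fun n : ℕ => (2 / 3 : ℝ) * (z ^ (2 * n) / ((2 * n).factorial : ℝ)))
      (2 / 3 * Real.cosh z) := (Real.hasSum_cosh z).mul_left _
  have h2 : HasSum (fun n : ℕ => (z ^ 2 / 3) ^ n / (n.factorial : ℝ)) (Real.exp (z ^ 2 / 3)) := by
    rw [Real.exp_eq_exp_ℝ]
    exact NormedSpace.expSeries_div_hasSum_exp (z ^ 2 / 3)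
  have h3 := (hasSum_nat_add_iff' 1).2 h1
  have h4 := (hasSum_nat_add_iff' 1).2 h2
  -- Termwise comparison of the two power series from the quadratic term on, where the coefficients
  -- agree; the constant terms are split off.
  have hf : ∀ n : ℕ, 2 * 3 ^ n * ((n + 1).factorial : ℝ) ≤ ((2 * (n + 1)).factorial : ℝ) := by
    intro n
    induction n with
    | zero => norm_num
    | succ n ih =>
      have e : 2 * (n + 1 + 1) = 2 * (n + 1) + 1 + 1 := by ring
      rw [e, Nat.factorial_succ (2 * (n + 1) + 1), Nat.factorial_succ (2 * (n + 1)),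
        Nat.factorial_succ (n + 1)]
      push_cast
      have hp : (0 : ℝ) < ((2 * (n + 1)).factorial : ℝ) := by positivity
      calc 2 * 3 ^ (n + 1) * (((n : ℝ) + 1 + 1) * ((n + 1).factorial : ℝ))
          = (3 * (n + 1 + 1)) * (2 * 3 ^ n * ((n + 1).factorial : ℝ)) := by ring
        _ ≤ (3 * (n + 1 + 1)) * ((2 * (n + 1)).factorial : ℝ) := by gcongr
        _ ≤ ((2 * ((n : ℝ) + 1) + 1 + 1) * (2 * (n + 1) + 1)) * ((2 * (n + 1)).factorial : ℝ) := by
          refine mul_le_mul_of_nonneg_right ?_ hp.le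
          nlinarith [(Nat.cast_nonneg n : (0 : ℝ) ≤ n)]
        _ = _ := by ring
  have := hasSum_le (fun n => ?_) h3 h4
  · norm_num at this
    linarith
  · have hq := hf n
    have hz : 0 ≤ z ^ (2 * (n + 1)) := by rw [pow_mul]; positivity
    have e1 : (z ^ 2 / 3) ^ (n + 1) / ((n + 1).factorial : ℝ)
        = z ^ (2 * (n + 1)) * (1 / (3 ^ (n + 1) * ((n + 1).factorial : ℝ))) := by
      rw [div_pow, ← pow_mul]; field_simp
    have e2 : (2 / 3 : ℝ) * (z ^ (2 * (n + 1)) / ((2 * (n + 1)).factorial : ℝ))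
        = z ^ (2 * (n + 1)) * (2 / (3 * ((2 * (n + 1)).factorial : ℝ))) := by
      field_simp
    rw [e1, e2]
    refine mul_le_mul_of_nonneg_left ?_ hz
    rw [div_le_div_iff₀ (by positivity) (by positivity)]
    calc 2 * (3 ^ (n + 1) * ((n + 1).factorial : ℝ))
        = 3 * (2 * 3 ^ n * ((n + 1).factorial : ℝ)) := by ring
      _ ≤ 3 * ((2 * (n + 1)).factorial : ℝ) := by gcongr
      _ = _ := by ring

lemma four_mul_log_two_lt : 4 * Real.log 2 < 2.7727 := by
  have := Real.log_two_lt_d9; linarith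

/-- `2 z cosh z - 3 log 2 sinh z` is strictly convex on the half line. -/
lemma strictConvexOn_two_mul_cosh_sub_sinh :
    StrictConvexOn ℝ (Set.Ici 0)
      (fun z : ℝ => 2 * z * Real.cosh z - 3 * Real.log 2 * Real.sinh z) := by
  have d1 : ∀ z : ℝ, HasDerivAt (fun z : ℝ => 2 * z * Real.cosh z - 3 * Real.log 2 * Real.sinh z)
      (2 * Real.cosh z + 2 * z * Real.sinh z - 3 * Real.log 2 * Real.cosh z) z := by
    intro z
    have h := (((hasDerivAt_id z).const_mul 2).mul (Real.hasDerivAt_cosh z)).sub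
      ((Real.hasDerivAt_sinh z).const_mul (3 * Real.log 2))
    refine h.congr_deriv ?_
    simp
  have d2 : ∀ z : ℝ, HasDerivAt
      (fun z : ℝ => 2 * Real.cosh z + 2 * z * Real.sinh z - 3 * Real.log 2 * Real.cosh z)
      ((4 - 3 * Real.log 2) * Real.sinh z + 2 * z * Real.cosh z) z := by
    intro z
    have h := (((Real.hasDerivAt_cosh z).const_mul 2).add
      (((hasDerivAt_id z).const_mul 2).mul (Real.hasDerivAt_sinh z))).sub
      ((Real.hasDerivAt_cosh z).const_mul (3 * Real.log 2))
    refine h.congr_deriv ?_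
    simp
    ring
  refine strictConvexOn_of_deriv2_pos (convex_Ici 0)
    (fun z _ => (d1 z).continuousAt.continuousWithinAt) ?_
  intro z hz
  rw [interior_Ici] at hz
  have hz : 0 < z := hz
  have e1 : deriv (fun z : ℝ => 2 * z * Real.cosh z - 3 * Real.log 2 * Real.sinh z)
      = fun z => 2 * Real.cosh z + 2 * z * Real.sinh z - 3 * Real.log 2 * Real.cosh z :=
    funext fun z => (d1 z).deriv
  rw [Function.iterate_succ, Function.iterate_one, Function.comp_apply, e1, (d2 z).deriv]
  have := four_mul_log_two_lt
  have hs : 0 < Real.sinh z := Real.sinh_pos_iff.2 hz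
  have hc := Real.cosh_pos z
  have : 0 < (4 - 3 * Real.log 2) * Real.sinh z := mul_pos (by linarith) hs
  positivity

lemma cosh_half_log_two_eq : 2 * (Real.log 2 / 2) * Real.cosh (Real.log 2 / 2)
    - 3 * Real.log 2 * Real.sinh (Real.log 2 / 2) = 0 := by
  have h : Real.exp (Real.log 2 / 2) = 2 * Real.exp (-(Real.log 2 / 2)) := by
    rw [show Real.log 2 / 2 = Real.log 2 + -(Real.log 2 / 2) by ring, Real.exp_add,
      Real.exp_log (by norm_num)]
    ring_nf
  rw [Real.cosh_eq, Real.sinh_eq, h]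
  ring

/-- `log cosh z - z² / (3 log 2)` is maximal exactly at `|z| = log 2 / 2`. -/
lemma log_cosh_sub_lt {z : ℝ} (hz : |z| ≠ Real.log 2 / 2) :
    Real.log (Real.cosh z) - z ^ 2 / (3 * Real.log 2) <
      Real.log (Real.cosh (Real.log 2 / 2)) - (Real.log 2 / 2) ^ 2 / (3 * Real.log 2) := by
  have hL : 0 < Real.log 2 := Real.log_pos (by norm_num)
  set L := Real.log 2 with hLdef
  set k : ℝ → ℝ := fun z => 2 * z * Real.cosh z - 3 * L * Real.sinh z with hk
  have hconv : StrictConvexOn ℝ (Set.Ici 0) k := strictConvexOn_two_mul_cosh_sub_sinh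
  have k0 : k 0 = 0 := by simp [hk]
  have k1 : k (L / 2) = 0 := cosh_half_log_two_eq
  set f : ℝ → ℝ := fun z => Real.log (Real.cosh z) - z ^ 2 / (3 * L) with hf
  -- `f'` has the sign of `-k`. As `k` is strictly convex and vanishes at `0` and `L / 2`, it is
  -- negative between these zeros and positive beyond, so `f` rises up to `L / 2` and falls after
  -- it.
  have df : ∀ z, HasDerivAt f (-(k z) / (3 * L * Real.cosh z)) z := by
    intro z
    have hc := Real.cosh_pos z
    have h := ((Real.hasDerivAt_cosh z).log hc.ne').sub (((hasDerivAt_id z).pow 2).div_const (3 * L))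
    refine h.congr_deriv ?_
    simp [hk]
    field_simp
  have hcont : Continuous f := continuous_iff_continuousAt.2 fun z => (df z).continuousAt
  have neg : ∀ z, 0 < z → z < L / 2 → k z < 0 := by
    intro z h0 h1
    have := hconv.2 (show (0 : ℝ) ∈ Set.Ici 0 by simp)
      (show L / 2 ∈ Set.Ici 0 by simp; positivity) (by positivity)
      (show 0 < 1 - z / (L / 2) by rw [sub_pos, div_lt_one (by positivity)]; exact h1)
      (show 0 < z / (L / 2) by positivity) (by ring)
    simp only [smul_eq_mul, mul_zero, zero_add, k0, k1] at this
    rwa [div_mul_cancel₀ _ (by positivity)] at this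
  have pos : ∀ z, L / 2 < z → 0 < k z := by
    intro z h1
    have hz : 0 < z := by linarith
    have := hconv.2 (show (0 : ℝ) ∈ Set.Ici 0 by simp)
      (show z ∈ Set.Ici 0 by simp; positivity) hz.ne
      (show 0 < 1 - (L / 2) / z by rw [sub_pos, div_lt_one hz]; exact h1)
      (show 0 < (L / 2) / z by positivity) (by ring)
    simp only [smul_eq_mul, mul_zero, zero_add, k0] at this
    rw [div_mul_cancel₀ _ hz.ne', k1] at this
    exact pos_of_mul_pos_right this (by positivity)
  have hmono : StrictMonoOn f (Set.Icc 0 (L / 2)) := by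
    refine strictMonoOn_of_deriv_pos (convex_Icc _ _) hcont.continuousOn ?_
    intro z hz
    rw [interior_Icc] at hz
    rw [(df z).deriv]
    have := neg z hz.1 hz.2
    have hc := Real.cosh_pos z
    exact div_pos (by linarith) (by positivity)
  have hanti : StrictAntiOn f (Set.Ici (L / 2)) := by
    refine strictAntiOn_of_deriv_neg (convex_Ici _) hcont.continuousOn ?_
    intro z hz
    rw [interior_Ici] at hz
    rw [(df z).deriv]
    have := pos z hz
    have hc := Real.cosh_pos z
    exact div_neg_of_neg_of_pos (by linarith) (by positivity)
  have key : f |z| < f (L / 2) := by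
    rcases lt_or_gt_of_ne hz with h | h
    · exact hmono ⟨abs_nonneg z, h.le⟩ ⟨by positivity, le_rfl⟩ h
    · exact hanti Set.self_mem_Ici h.le h
  simpa [hf, Real.cosh_abs, sq_abs] using key

/-- The dual free energy `log ∑ exp (2 β y_c) - β ∑ y_c²` at the critical parameter. -/
def dualEnergy (y : Fin 3 → ℝ) : ℝ :=
  Real.log (∑ c, Real.exp (4 * Real.log 2 * y c)) - 2 * Real.log 2 * ∑ c, y c ^ 2

/-- On the line where two colours are equal, the critical energy is even about the point `(1/2, 1/4,
1/4)`. This is the coexistence of phases: `d = 1/4` is an ordered centre and `d = -1/4` the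
disordered one, at the same height. -/
lemma log_symmetric_sub (d : ℝ) :
    Real.log (Real.exp (4 * Real.log 2 * (1 / 2 + 2 * d / 3))
        + 2 * Real.exp (4 * Real.log 2 * (1 / 4 - d / 3)))
      - 2 * Real.log 2 * ((1 / 2 + 2 * d / 3) ^ 2 + 2 * (1 / 4 - d / 3) ^ 2)
    = 9 / 4 * Real.log 2 + (Real.log (Real.cosh (2 * Real.log 2 * d))
        - (2 * Real.log 2 * d) ^ 2 / (3 * Real.log 2)) := by
  have hL : 0 < Real.log 2 := Real.log_pos (by norm_num)
  have h : Real.exp (4 * Real.log 2 * (1 / 2 + 2 * d / 3))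
        + 2 * Real.exp (4 * Real.log 2 * (1 / 4 - d / 3))
      = Real.exp (3 * Real.log 2 + 2 * Real.log 2 * d / 3) * Real.cosh (2 * Real.log 2 * d) := by
    have e2 : (2 : ℝ) = Real.exp (Real.log 2) := (Real.exp_log (by norm_num)).symm
    have e3 : Real.cosh (2 * Real.log 2 * d) = Real.exp (-Real.log 2) *
        (Real.exp (2 * Real.log 2 * d) + Real.exp (-(2 * Real.log 2 * d))) := by
      rw [Real.cosh_eq, Real.exp_neg (Real.log 2), Real.exp_log (by norm_num)]; ring
    rw [e3, ← mul_assoc, ← Real.exp_add, mul_add (Real.exp _), ← Real.exp_add, ← Real.exp_add]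
    congr 1
    · congr 1; ring
    · nth_rewrite 1 [e2]
      rw [← Real.exp_add]; congr 1; ring
  rw [h, Real.log_mul (Real.exp_pos _).ne' (Real.cosh_pos _).ne', Real.log_exp]
  field_simp
  ring

/-- The maximal value of the dual free energy. -/
def maxEnergy : ℝ := 9 / 4 * Real.log 2 + (Real.log (Real.cosh (Real.log 2 / 2))
  - (Real.log 2 / 2) ^ 2 / (3 * Real.log 2))

/-- With `x` the largest coordinate, `d` parametrises the symmetric line and `e` the asymmetry of
the two smaller ones. Asymmetry gains at most `(4 L e) ^ 2 / 3` in the logarithm and costs `4 L e ^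
2` in the quadratic term; the cost wins because `4 log 2 < 3`. What remains is the function of `d`
treated in `log_cosh_sub_lt`. -/
lemma log_sum_exp_sub_le {x y z : ℝ} (hs : x + y + z = 1) (hy : y ≤ x) (hz : z ≤ x) :
    Real.log (Real.exp (4 * Real.log 2 * x) + (Real.exp (4 * Real.log 2 * y)
      + Real.exp (4 * Real.log 2 * z))) - 2 * Real.log 2 * (x ^ 2 + (y ^ 2 + z ^ 2)) < maxEnergy ∨
    (y = z ∧ (x = 1 / 3 ∨ x = 2 / 3)) := by
  have hL : 0 < Real.log 2 := Real.log_pos (by norm_num)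
  have hL4 := four_mul_log_two_lt
  set L := Real.log 2 with hLd
  obtain ⟨d, rfl⟩ : ∃ d, x = 1 / 2 + 2 * d / 3 := ⟨(x - 1 / 2) * 3 / 2, by ring⟩
  obtain ⟨e, rfl⟩ : ∃ e, y = 1 / 4 - d / 3 + e := ⟨y - (1 / 4 - d / 3), by ring⟩
  obtain rfl : z = 1 / 4 - d / 3 - e := by linarith
  set A := Real.exp (4 * L * (1 / 2 + 2 * d / 3)) with hA
  set B := Real.exp (4 * L * (1 / 4 - d / 3)) with hB
  have hA0 : 0 < A := Real.exp_pos _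
  have hB0 : 0 < B := Real.exp_pos _
  have hAB : B ≤ A := Real.exp_le_exp.2 (by nlinarith)
  have hsum : Real.exp (4 * L * (1 / 4 - d / 3 + e)) + Real.exp (4 * L * (1 / 4 - d / 3 - e))
      = 2 * B * Real.cosh (4 * L * e) := by
    rw [Real.cosh_eq, hB]
    have : ∀ u v w : ℝ, 2 * u * ((v + w) / 2) = u * v + u * w := by intros; ring
    rw [this, ← Real.exp_add, ← Real.exp_add]
    congr 2 <;> ring
  rw [hsum]
  have hc1 := Real.one_le_cosh (4 * L * e)
  -- As `B ≤ A`, replacing the weights by equal ones only increases the relative effect of `cosh`;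
  -- the uniform law on three points is the worst case.
  have hle : A + 2 * B * Real.cosh (4 * L * e)
      ≤ (A + 2 * B) * Real.exp ((4 * L * e) ^ 2 / 3) := by
    refine le_trans ?_ (mul_le_mul_of_nonneg_left (one_add_two_cosh_le _) (by positivity))
    nlinarith [mul_nonneg (sub_nonneg.2 hAB) (sub_nonneg.2 hc1)]
  have hlog := Real.log_le_log (by positivity) hle
  rw [Real.log_mul (by positivity) (Real.exp_pos _).ne', Real.log_exp] at hlog
  have hsym := log_symmetric_sub d
  rw [← hLd, ← hA, ← hB] at hsym
  have hsq : (4 * L * e) ^ 2 / 3 ≤ 4 * L * e ^ 2 := by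
    nlinarith [mul_nonneg hL.le (sq_nonneg e)]
  have hmax : L * 9 / 4 + (Real.log (Real.cosh (2 * L * d)) - (2 * L * d) ^ 2 / (3 * L)) ≤ maxEnergy := by
    by_cases hd : |2 * L * d| = L / 2
    · rw [maxEnergy, ← hLd, ← hd, Real.cosh_abs, sq_abs]; linarith
    · have := log_cosh_sub_lt hd
      rw [maxEnergy]; linarith
  by_cases he : e = 0
  · by_cases hd : |2 * L * d| = L / 2
    · right
      refine ⟨by rw [he]; ring, ?_⟩
      rw [abs_mul, abs_of_pos (by positivity : 0 < 2 * L)] at hd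
      have hd' : |d| = 1 / 4 := by
        have : 2 * L * |d| = 2 * L * (1 / 4) := by rw [hd]; ring
        exact mul_left_cancel₀ (by positivity) this
      rcases (abs_eq (by norm_num)).1 hd' with h | h
      · right; rw [h]; norm_num
      · left; rw [h]; norm_num
    · left
      have := log_cosh_sub_lt hd
      rw [← hLd] at this
      have hm : maxEnergy = 9 / 4 * L + (Real.log (Real.cosh (L / 2)) - (L / 2) ^ 2 / (3 * L)) := rfl
      nlinarith
  · left
    have he2 : 0 < e ^ 2 := by positivity
    have hsq' : (4 * L * e) ^ 2 / 3 < 4 * L * e ^ 2 := by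
      nlinarith [mul_pos hL he2]
    nlinarith

lemma dualEnergy_lt {y : Fin 3 → ℝ} (hs : ∑ c, y c = 1) (hne : ∀ j, y ≠ centre j) :
    dualEnergy y < maxEnergy := by
  rw [Fin.sum_univ_three] at hs
  have key : ∀ {x y z : ℝ}, x + y + z = 1 → y ≤ x → z ≤ x →
      ¬ (y = z ∧ (x = 1 / 3 ∨ x = 2 / 3)) → _ :=
    fun hs hy hz hn => (log_sum_exp_sub_le hs hy hz).resolve_right hn
  have hc : ∀ j : Fin 4, y = centre j ↔
      y 0 = centre j 0 ∧ y 1 = centre j 1 ∧ y 2 = centre j 2 := by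
    intro j
    simp [funext_iff, Fin.forall_fin_succ]
  have h0 := hne 0
  have h1 := hne 1
  have h2 := hne 2
  have h3 := hne 3
  rw [Ne, hc] at h0 h1 h2 h3
  simp [centre] at h0 h1 h2 h3
  simp only [dualEnergy, Fin.sum_univ_three]
  by_cases h01 : y 1 ≤ y 0
  · by_cases h02 : y 2 ≤ y 0
    · have := key hs h01 h02 (by
        rintro ⟨e, h | h⟩
        · exact h3 (by linarith) (by linarith) (by linarith)
        · exact h0 (by linarith) (by linarith) (by linarith))
      simpa only [add_assoc] using this
    · have := key (x := y 2) (y := y 0) (z := y 1) (by linarith) (by linarith) (by linarith) (by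
        rintro ⟨e, h | h⟩
        · exact h3 (by linarith) (by linarith) (by linarith)
        · exact h2 (by linarith) (by linarith) (by linarith))
      convert this using 2
      · congr 1; ring
      · ring
  · by_cases h12 : y 2 ≤ y 1
    · have := key (x := y 1) (y := y 2) (z := y 0) (by linarith) (by linarith) (by linarith) (by
        rintro ⟨e, h | h⟩
        · exact h3 (by linarith) (by linarith) (by linarith)
        · exact h1 (by linarith) (by linarith) (by linarith))
      convert this using 2
      · congr 1; ring
      · ring
    · have := key (x := y 2) (y := y 0) (z := y 1) (by linarith) (by linarith) (by linarith) (by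
        rintro ⟨e, h | h⟩
        · exact h3 (by linarith) (by linarith) (by linarith)
        · exact h2 (by linarith) (by linarith) (by linarith))
      convert this using 2
      · congr 1; ring
      · ring

lemma dualEnergy_centre (i : Fin 4) : dualEnergy (centre i) = maxEnergy := by
  have hL : 0 < Real.log 2 := Real.log_pos (by norm_num)
  have h1 := log_symmetric_sub (1 / 4)
  have h2 := log_symmetric_sub (-(1 / 4))
  rw [show 2 * Real.log 2 * (1 / 4) = Real.log 2 / 2 by ring] at h1
  rw [show 2 * Real.log 2 * -(1 / 4) = -(Real.log 2 / 2) by ring, Real.cosh_neg, neg_sq] at h2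
  rw [maxEnergy]
  fin_cases i
  all_goals
    simp only [dualEnergy, Fin.sum_univ_three, centre]
  · rw [← h1]; simp; norm_num; ring_nf
  · rw [← h1]; simp; norm_num; ring_nf
  · rw [← h1]; simp; norm_num; ring_nf
  · rw [← h2]; simp; norm_num; ring_nf

lemma continuous_dualEnergy : Continuous dualEnergy := by
  unfold dualEnergy
  refine Continuous.sub (Continuous.log (by fun_prop) fun y => ?_) (by fun_prop)
  exact (Finset.sum_pos (fun c _ => Real.exp_pos _) Finset.univ_nonempty).ne'

/-! ### Colour ratios, conditional probabilities and resampling operators -/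

variable {M : ℕ}

/-- The Boltzmann weights `exp (2 β x_c)`, normalised to a probability vector. -/
def softmax (x : Fin 3 → ℝ) (c : Fin 3) : ℝ :=
  Real.exp (4 * Real.log 2 * x c) / ∑ b, Real.exp (4 * Real.log 2 * x b)

lemma sum_exp_pos (x : Fin 3 → ℝ) : 0 < ∑ b, Real.exp (4 * Real.log 2 * x b) :=
  Finset.sum_pos (fun _ _ => Real.exp_pos _) Finset.univ_nonempty

lemma softmax_pos (x : Fin 3 → ℝ) (c : Fin 3) : 0 < softmax x c :=
  div_pos (Real.exp_pos _) (sum_exp_pos x)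

lemma sum_softmax (x : Fin 3 → ℝ) : ∑ c, softmax x c = 1 := by
  simp only [softmax]
  rw [← Finset.sum_div, div_self (sum_exp_pos x).ne']

/-- The contribution to the colour ratios of all spins except the one at `v`. -/
def othersRatio (σ : Config M) (v : Fin M) (c : Fin 3) : ℝ :=
  ratio σ c - if σ v = c then 1 / (M : ℝ) else 0

lemma ratio_eq_sum (σ : Config M) (c : Fin 3) :
    ratio σ c = (∑ l, if σ l = c then (1 : ℝ) else 0) / M := by
  simp [ratio]

lemma othersRatio_eq_sum (σ : Config M) (v : Fin M) (c : Fin 3) :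
    othersRatio σ v c = (∑ l ∈ Finset.univ.erase v, if σ l = c then (1 : ℝ) else 0) / M := by
  rw [othersRatio, ratio_eq_sum, ← Finset.add_sum_erase _ _ (Finset.mem_univ v)]
  split_ifs <;> ring

lemma othersRatio_update_same (σ : Config M) (v : Fin M) (a : Fin 3) :
    othersRatio (Function.update σ v a) v = othersRatio σ v := by
  funext c
  rw [othersRatio_eq_sum, othersRatio_eq_sum]
  congr 1
  refine Finset.sum_congr rfl fun l hl => ?_
  rw [Function.update_of_ne (Finset.ne_of_mem_erase hl)]

lemma ratio_update (σ : Config M) (v : Fin M) (a c : Fin 3) :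
    ratio (Function.update σ v a) c = othersRatio σ v c + if a = c then 1 / (M : ℝ) else 0 := by
  have h := congrFun (othersRatio_update_same σ v a) c
  rw [othersRatio, Function.update_self] at h
  linarith

lemma othersRatio_update_of_ne (σ : Config M) {v w : Fin M} (h : v ≠ w) (a c : Fin 3) :
    othersRatio (Function.update σ w a) v c
      = othersRatio σ v c + ((if a = c then 1 / (M : ℝ) else 0)
        - if σ w = c then 1 / (M : ℝ) else 0) := by
  rw [othersRatio, ratio_update, Function.update_of_ne h, othersRatio, othersRatio]
  ring

lemma sum_ratio (hM : M ≠ 0) (σ : Config M) : ∑ c, ratio σ c = 1 := by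
  have hM' : (M : ℝ) ≠ 0 := by exact_mod_cast hM
  simp only [ratio_eq_sum]
  rw [← Finset.sum_div, Finset.sum_comm]
  simp [hM']

lemma ratio_nonneg (σ : Config M) (c : Fin 3) : 0 ≤ ratio σ c := by
  unfold ratio; positivity

lemma sum_ite_ratio (hM : M ≠ 0) (σ : Config M) (c : Fin 3) :
    (∑ l, if σ l = c then (1 : ℝ) else 0) = M * ratio σ c := by
  have hM' : (M : ℝ) ≠ 0 := by exact_mod_cast hM
  rw [ratio_eq_sum]; field_simp

/-- Resampling a uniformly chosen spin `v` of `σ` with the probabilities `q σ v`,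
as an operator on functions. -/
def resample (q : Config M → Fin M → Fin 3 → ℝ) (h : Config M → ℝ) (σ : Config M) : ℝ :=
  (1 / (M : ℝ)) * ∑ v, ∑ c, q σ v c * h (Function.update σ v c)

lemma glauber_mulVec (μ h : Config M → ℝ) :
    (glauber μ).mulVec h = resample (condProb μ) h := by
  funext σ
  simp only [Matrix.mulVec, dotProduct, glauber, Matrix.of_apply, resample]
  simp only [mul_assoc, Finset.sum_mul, ← Finset.mul_sum]
  congr 1
  rw [Finset.sum_comm]
  refine Finset.sum_congr rfl fun v _ => ?_
  rw [Finset.sum_comm]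
  refine Finset.sum_congr rfl fun c _ => ?_
  simp

lemma sum_weight_pos (β : ℝ) (M : ℕ) : 0 < ∑ τ : Config M, weight β τ :=
  Finset.sum_pos (fun _ _ => Real.exp_pos _) Finset.univ_nonempty

/-- Adding a spin of colour `b` raises the square of its ratio by `2 y_b / M + 1 / M ^ 2`.
Multiplied by `M * criticalBeta`, the part depending on `b` is `4 log 2 * y_b`; the rest, collected
in `A`, cancels. -/
lemma condProb_gibbs (hM : M ≠ 0) (σ : Config M) (v : Fin M) :
    condProb (gibbs criticalBeta M) σ v = softmax (othersRatio σ v) := by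
  funext c
  have hM' : (M : ℝ) ≠ 0 := by exact_mod_cast hM
  set y := othersRatio σ v with hy
  set A := (M : ℝ) * criticalBeta * (∑ d, y d ^ 2 + 1 / (M : ℝ) ^ 2) with hA
  have hw : ∀ b, weight criticalBeta (Function.update σ v b)
      = Real.exp A * Real.exp (4 * Real.log 2 * y b) := by
    intro b
    rw [weight, ← Real.exp_add]
    congr 1
    have : ∑ d, ratio (Function.update σ v b) d ^ 2
        = ∑ d, y d ^ 2 + (2 * y b / M + 1 / (M : ℝ) ^ 2) := by
      simp only [ratio_update, ← hy, add_sq, Finset.sum_add_distrib]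
      rw [add_assoc]
      congr 1
      simp
      ring
    rw [this, hA, criticalBeta]
    field_simp
    ring
  simp only [condProb, gibbs, hw, softmax]
  have hZ := (sum_weight_pos criticalBeta M).ne'
  rw [← Finset.sum_div, ← Finset.mul_sum]
  have := (sum_exp_pos y).ne'
  have := (Real.exp_pos A).ne'
  field_simp

section Resample

variable {q : Config M → Fin M → Fin 3 → ℝ}

/-- A bound that holds after every possible move holds after resampling. -/
lemma resample_le_of_forall (hM : M ≠ 0) (hq : ∀ σ v c, 0 ≤ q σ v c) (hs : ∀ σ v, ∑ c, q σ v c = 1)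
    {h : Config M → ℝ} {σ : Config M} {B : ℝ} (hB : ∀ v c, h (Function.update σ v c) ≤ B) :
    resample q h σ ≤ B := by
  have hM' : (0 : ℝ) < M := by exact_mod_cast Nat.pos_of_ne_zero hM
  have : ∑ v, ∑ c, q σ v c * h (Function.update σ v c) ≤ ∑ _v : Fin M, B := by
    refine Finset.sum_le_sum fun v _ => ?_
    calc ∑ c, q σ v c * h (Function.update σ v c) ≤ ∑ c, q σ v c * B :=
          Finset.sum_le_sum fun c _ => mul_le_mul_of_nonneg_left (hB v c) (hq σ v c)
      _ = B := by rw [← Finset.sum_mul, hs, one_mul]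
  rw [Finset.sum_const, Finset.card_univ, Fintype.card_fin, nsmul_eq_mul] at this
  rw [resample, one_div, inv_mul_le_iff₀ hM']
  exact this

lemma resample_mono (hq : ∀ σ v c, 0 ≤ q σ v c) {h g : Config M → ℝ} {σ : Config M}
    (hB : ∀ τ, h τ ≤ g τ) :
    resample q h σ ≤ resample q g σ := by
  unfold resample
  refine mul_le_mul_of_nonneg_left ?_ (by positivity)
  exact Finset.sum_le_sum fun v _ => Finset.sum_le_sum fun c _ =>
    mul_le_mul_of_nonneg_left (hB _) (hq σ v c)

lemma resample_add (h g : Config M → ℝ) (σ : Config M) :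
    resample q (fun τ => h τ + g τ) σ = resample q h σ + resample q g σ := by
  simp only [resample, mul_add, Finset.sum_add_distrib]

lemma resample_sub (h g : Config M → ℝ) (σ : Config M) :
    resample q (fun τ => h τ - g τ) σ = resample q h σ - resample q g σ := by
  simp only [resample, mul_sub, Finset.sum_sub_distrib]

lemma resample_const_mul (a : ℝ) (h : Config M → ℝ) (σ : Config M) :
    resample q (fun τ => a * h τ) σ = a * resample q h σ := by
  simp only [resample, mul_left_comm _ a, ← Finset.mul_sum]

lemma resample_neg (h : Config M → ℝ) (σ : Config M) :
    resample q (fun τ => - h τ) σ = - resample q h σ := by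
  simp only [resample, mul_neg, Finset.sum_neg_distrib]

lemma resample_const (hM : M ≠ 0) (hs : ∀ σ v, ∑ c, q σ v c = 1) (B : ℝ) (σ : Config M) :
    resample q (fun _ => B) σ = B := by
  have hM' : (M : ℝ) ≠ 0 := by exact_mod_cast hM
  simp only [resample, ← Finset.sum_mul, hs]
  simp [hM']

lemma abs_resample_le (hq : ∀ σ v c, 0 ≤ q σ v c) {h g : Config M → ℝ} {σ : Config M}
    (hB : ∀ τ, |h τ| ≤ g τ) : |resample q h σ| ≤ resample q g σ := by
  rw [abs_le]
  constructor
  · rw [neg_le, ← resample_neg]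
    exact resample_mono hq fun τ => (neg_le_abs _).trans (hB τ)
  · exact resample_mono hq fun τ => (le_abs_self _).trans (hB τ)

lemma abs_iterate_resample_le (hM : M ≠ 0) (hq : ∀ σ v c, 0 ≤ q σ v c)
    (hs : ∀ σ v, ∑ c, q σ v c = 1) {h : Config M → ℝ} {B : ℝ} (hB : ∀ τ, |h τ| ≤ B) (k : ℕ) :
    ∀ σ, |(resample q)^[k] h σ| ≤ B := by
  induction k with
  | zero => exact hB
  | succ k ih =>
    intro σ
    rw [Function.iterate_succ_apply']
    exact (abs_resample_le hq ih).trans (resample_const hM hs B σ).le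

end Resample

/-! ### Contraction of the clipped dynamics -/

lemma exists_third {a b : Fin 3} (hab : a ≠ b) :
    ∃ d, d ≠ a ∧ d ≠ b ∧ ∀ f : Fin 3 → ℝ, ∑ c, f c = f a + f b + f d := by
  fin_cases a <;> fin_cases b <;> simp at hab
  · exact ⟨2, by decide, by decide, fun f => by simp [Fin.sum_univ_three]⟩
  · exact ⟨1, by decide, by decide, fun f => by simp [Fin.sum_univ_three]; ring⟩
  · exact ⟨2, by decide, by decide, fun f => by simp [Fin.sum_univ_three]; ring⟩
  · exact ⟨0, by decide, by decide, fun f => by simp [Fin.sum_univ_three]; ring⟩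
  · exact ⟨1, by decide, by decide, fun f => by simp [Fin.sum_univ_three]; ring⟩
  · exact ⟨0, by decide, by decide, fun f => by simp [Fin.sum_univ_three]; ring⟩

/-- The change of `A / (A + B + D)` when `A` grows and `B` shrinks by a factor at most `R`. -/
lemma div_sub_div_le {A A' B B' D R θ : ℝ} (hA : 0 < A) (hB : 0 < B) (hD : 0 < D) (hR : 1 ≤ R)
    (h1 : A ≤ A') (h2 : A' ≤ R * A) (h3 : B' ≤ B) (h4 : B ≤ R * B')
    (hθ : (R - 1) * R * (A * (2 * B + D)) ≤ θ * (A + B + D) ^ 2) :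
    A' / (A' + B' + D) - A / (A + B + D) ≤ θ := by
  have hB' : 0 < B' := by
    by_contra h
    nlinarith
  have hA' : 0 < A' := hA.trans_le h1
  have hZ : 0 < A + B + D := by positivity
  have hZ' : 0 < A' + B' + D := by positivity
  have hR0 : 0 < R := by linarith
  have hRZ : A + B + D ≤ R * (A' + B' + D) := by nlinarith
  have hθ0 : 0 ≤ θ := by
    by_contra h
    have : 0 ≤ (R - 1) * R * (A * (2 * B + D)) :=
      mul_nonneg (mul_nonneg (sub_nonneg.2 hR) hR0.le) (by positivity)
    nlinarith [mul_pos_of_neg_of_neg (not_le.1 h) (neg_lt_zero.2 (pow_pos hZ 2))]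
  rw [div_sub_div _ _ hZ'.ne' hZ.ne', div_le_iff₀ (by positivity)]
  have e : A' * (A + B + D) - (A' + B' + D) * A = (A' * B - A * B') + (A' - A) * D := by ring
  have i1 : A' * B - A * B' ≤ 2 * (R - 1) * (A * B) := by
    have : B' ≥ (2 - R) * B := by nlinarith [sq_nonneg (R - 1)]
    nlinarith
  have i2 : (A' - A) * D ≤ (R - 1) * A * D := by
    refine mul_le_mul_of_nonneg_right (by linarith) hD.le
  rw [e]
  have i3 : (A' * B - A * B') + (A' - A) * D ≤ (R - 1) * (A * (2 * B + D)) := by nlinarith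
  have i4 : R * ((R - 1) * (A * (2 * B + D))) ≤ R * (θ * ((A' + B' + D) * (A + B + D))) := by
    calc R * ((R - 1) * (A * (2 * B + D))) = (R - 1) * R * (A * (2 * B + D)) := by ring
      _ ≤ θ * (A + B + D) ^ 2 := hθ
      _ = θ * (A + B + D) * (A + B + D) := by ring
      _ ≤ θ * (A + B + D) * (R * (A' + B' + D)) := by gcongr
      _ = _ := by ring
  exact i3.trans (le_of_mul_le_mul_left i4 hR0)

/-- Integrating a function of small oscillation against a difference of probability vectors. -/
lemma abs_sum_mul_le {D h : Fin 3 → ℝ} {a b : Fin 3} {α θ : ℝ} (hab : a ≠ b) (hD : ∑ c, D c = 0)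
    (ha : 0 ≤ D a) (ha' : D a ≤ θ) (hb : D b ≤ 0) (hb' : -D b ≤ θ)
    (hh : ∀ c d, |h c - h d| ≤ α) : |∑ c, D c * h c| ≤ α * θ := by
  obtain ⟨d, -, -, hsum⟩ := exists_third hab
  rw [hsum] at hD ⊢
  have hα : 0 ≤ α := (abs_nonneg _).trans (hh a b)
  have hab' := hh a b
  have hdb := hh d b
  have had := hh a d
  -- The third colour joins the gaining or the losing side. In both cases a total mass of at most
  -- `θ` is transported, and each unit of it changes the integral by at most `α`.
  rcases le_total 0 (D d) with hd | hd
  · have : D a * h a + D b * h b + D d * h d = D a * (h a - h b) + D d * (h d - h b) := by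
      have : D b = - D a - D d := by linarith
      rw [this]; ring
    rw [this]
    refine (abs_add_le _ _).trans ?_
    rw [abs_mul, abs_mul, abs_of_nonneg ha, abs_of_nonneg hd]
    nlinarith
  · have : D a * h a + D b * h b + D d * h d = - D b * (h a - h b) + - D d * (h a - h d) := by
      have : D a = - D b - D d := by linarith
      rw [this]; ring
    rw [this]
    refine (abs_add_le _ _).trans ?_
    rw [abs_mul, abs_mul, abs_of_nonneg (neg_nonneg.2 hb), abs_of_nonneg (neg_nonneg.2 hd)]
    nlinarith

/-- The mean-field equation: the centres are fixed points of `softmax`. For the ordered ones this is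
`exp (4 log 2 * (2/3 - 1/6)) = 4`, the ratio of `2/3` to `1/6`. -/
lemma exp_mul_centre (i : Fin 4) : ∃ K : ℝ, 0 < K ∧
    ∀ c, Real.exp (4 * Real.log 2 * centre i c) = K * centre i c := by
  have h4 : Real.exp (4 * Real.log 2 * (2 / 3)) = 4 * Real.exp (4 * Real.log 2 * (1 / 6)) := by
    rw [show 4 * Real.log 2 * (2 / 3) = Real.log 2 + (Real.log 2 + 4 * Real.log 2 * (1 / 6)) by ring,
      Real.exp_add, Real.exp_add, Real.exp_log (by norm_num)]
    ring
  refine ⟨if i = 3 then 3 * Real.exp (4 * Real.log 2 * (1 / 3))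
    else 6 * Real.exp (4 * Real.log 2 * (1 / 6)), by split_ifs <;> positivity, fun c => ?_⟩
  fin_cases i <;> fin_cases c <;> simp [centre] <;> norm_num at h4 ⊢ <;> linarith

/-- `p_a * (2 p_b + p_d)` is the derivative of the softmax probability `p_a` when the exponent of
`a` grows and that of `b` shrinks at unit speed. The value `1/3` is attained at the disordered
centre and at the ordered ones. -/
lemma centre_mul_le (i : Fin 4) {a b d : Fin 3} (hab : a ≠ b) (hda : d ≠ a) (hdb : d ≠ b) :
    centre i a * (2 * centre i b + centre i d) ≤ 1 / 3 := by
  fin_cases i <;> fin_cases a <;> fin_cases b <;> fin_cases d <;>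
    simp [centre] at hab hda hdb ⊢ <;> norm_num

lemma centre_pos (i : Fin 4) (c : Fin 3) : 0 < centre i c := by
  fin_cases i <;> fin_cases c <;> simp [centre]

lemma sum_centre (i : Fin 4) : ∑ c, centre i c = 1 := by
  rw [Fin.sum_univ_three]
  fin_cases i <;> simp [centre] <;> norm_num

/-- Truncation of each coordinate to the interval of radius `3 ρ` around the centre. -/
def clip (i : Fin 4) (x : Fin 3 → ℝ) (c : Fin 3) : ℝ :=
  max (centre i c - 3 * rho) (min (x c) (centre i c + 3 * rho))

lemma abs_clip_sub_le (i : Fin 4) (x : Fin 3 → ℝ) (c : Fin 3) :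
    |clip i x c - centre i c| ≤ 3 * rho := by
  have : 0 < rho := by norm_num [rho]
  rw [abs_le, clip]
  constructor
  · linarith [le_max_left (centre i c - 3 * rho) (min (x c) (centre i c + 3 * rho))]
  · have := max_le (by linarith : centre i c - 3 * rho ≤ centre i c + 3 * rho)
      (min_le_right (x c) (centre i c + 3 * rho))
    linarith

lemma clip_eq_self {i : Fin 4} {x : Fin 3 → ℝ} (h : ∀ c, |x c - centre i c| ≤ 3 * rho) :
    clip i x = x := by
  funext c
  have := abs_le.1 (h c)
  rw [clip, min_eq_left (by linarith), max_eq_right (by linarith)]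

lemma clip_mono_apply (i : Fin 4) {x y : Fin 3 → ℝ} {c : Fin 3} (h : x c ≤ y c) :
    clip i x c ≤ clip i y c := max_le_max le_rfl (min_le_min h le_rfl)

/-- Clipping is 1-Lipschitz as well as monotone, so a single spin flip shifts clipped coordinates in
the same direction and by no more than unclipped ones. -/
lemma clip_add_le (i : Fin 4) {x y : Fin 3 → ℝ} {c : Fin 3} {t : ℝ} (ht : 0 ≤ t)
    (h : y c ≤ x c + t) : clip i y c ≤ clip i x c + t := by
  rw [clip, clip]
  refine max_le ((le_max_left _ _).trans (by linarith)) ?_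
  rcases le_total (x c) (centre i c + 3 * rho) with h' | h'
  · rw [min_eq_left h']
    exact (min_le_left _ _).trans (h.trans (by gcongr; exact le_max_right _ _))
  · rw [min_eq_right h']
    have := le_max_right (centre i c - 3 * rho) (centre i c + 3 * rho)
    exact (min_le_right _ _).trans (by linarith)

/-- The update probabilities, frozen outside a small box around the centre. -/
def clippedProb (i : Fin 4) (σ : Config M) (v : Fin M) : Fin 3 → ℝ :=
  softmax (clip i (othersRatio σ v))

lemma exp_clip_bounds (i : Fin 4) : ∃ K : ℝ, 0 < K ∧ ∀ x c,
    K * centre i c * (1 - 1 / 10 ^ 5) ≤ Real.exp (4 * Real.log 2 * clip i x c) ∧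
    Real.exp (4 * Real.log 2 * clip i x c) ≤ K * centre i c * (1 + 1 / 10 ^ 5) := by
  obtain ⟨K, hK, h⟩ := exp_mul_centre i
  refine ⟨K, hK, fun x c => ?_⟩
  have hL : 0 < Real.log 2 := Real.log_pos (by norm_num)
  have hL4 := four_mul_log_two_lt
  set u := 4 * Real.log 2 * (clip i x c - centre i c) with hu
  -- Here `4 log 2 * 3 * rho` is about `8.32 / 10 ^ 6`; the quadratic remainder of `exp` still fits
  -- below `1 / 10 ^ 5`.
  have hu1 : |u| ≤ 9 / 10 ^ 6 := by
    rw [hu, abs_mul, abs_of_pos (by positivity)]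
    have := abs_clip_sub_le i x c
    rw [rho] at this
    nlinarith [abs_nonneg (clip i x c - centre i c)]
  have he : Real.exp (4 * Real.log 2 * clip i x c) = K * centre i c * Real.exp u := by
    rw [← h, ← Real.exp_add]; congr 1; rw [hu]; ring
  have hq := abs_le.1 (Real.abs_exp_sub_one_sub_id_le (x := u) (by norm_num at hu1 ⊢; linarith))
  have hu2 := abs_le.1 hu1
  have hsq : u ^ 2 ≤ 1 / 10 ^ 6 := by nlinarith
  have hKc : 0 < K * centre i c := mul_pos hK (centre_pos i c)
  rw [he]
  constructor <;> refine mul_le_mul_of_nonneg_left ?_ hKc.le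
  · have := Real.add_one_le_exp u
    linarith
  · nlinarith

lemma exp_sub_one_mul_exp_le (hM : (10 : ℝ) ^ 9 ≤ M) :
    (Real.exp (4 * Real.log 2 * (1 / M)) - 1) * Real.exp (4 * Real.log 2 * (1 / M))
      ≤ 2.774 / M := by
  have hM0 : (0 : ℝ) < M := by linarith [(by norm_num : (0 : ℝ) < 10 ^ 9)]
  have h1M : 1 / (M : ℝ) ≤ 1 / 10 ^ 9 := one_div_le_one_div_of_le (by norm_num) hM
  have hL : 0 < Real.log 2 := Real.log_pos (by norm_num)
  have hL4 := four_mul_log_two_lt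
  have hR1 : 1 ≤ Real.exp (4 * Real.log 2 * (1 / M)) := Real.one_le_exp (by positivity)
  set R := Real.exp (4 * Real.log 2 * (1 / M)) with hR
  set u := 4 * Real.log 2 * (1 / (M : ℝ)) with hu
  have hu0 : 0 ≤ u := by positivity
  have hu1 : u ≤ 3 / 10 ^ 9 := by
    rw [hu]; nlinarith [show 0 ≤ 1 / (M : ℝ) by positivity]
  have hq := (abs_le.1 (Real.abs_exp_sub_one_sub_id_le (x := u)
    (by rw [abs_of_nonneg hu0]; norm_num at hu1 ⊢; linarith))).2
  have hR2 : R ≤ 1 + 1.00001 * u := by rw [hR]; nlinarith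
  have hR3 : R ≤ 1.00001 := by nlinarith
  have hu3 : u ≤ 2.7727 * (1 / (M : ℝ)) := by
    rw [hu]; exact mul_le_mul_of_nonneg_right hL4.le (by positivity)
  have : (R - 1) * R ≤ (1.00001 * u) * 1.00001 :=
    mul_le_mul (by linarith) hR3 (by linarith) (by positivity)
  calc (R - 1) * R ≤ (1.00001 * u) * 1.00001 := this
    _ ≤ 2.774 * (1 / (M : ℝ)) := by nlinarith [show 0 ≤ 1 / (M : ℝ) by positivity]
    _ = _ := by ring

/-- The update probabilities of the clipped dynamics contract: the infinitesimal form of the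
bound on the change of a colour probability when one other spin is changed. -/
lemma clip_weights_le (hM : (10 : ℝ) ^ 9 ≤ M) (i : Fin 4) (x : Fin 3 → ℝ) {a' b' d' : Fin 3}
    (h1 : a' ≠ b') (h2 : d' ≠ a') (h3 : d' ≠ b')
    (hsum : ∀ f : Fin 3 → ℝ, ∑ c, f c = f a' + f b' + f d') :
    (Real.exp (4 * Real.log 2 * (1 / M)) - 1) * Real.exp (4 * Real.log 2 * (1 / M)) *
      (Real.exp (4 * Real.log 2 * clip i x a') *
        (2 * Real.exp (4 * Real.log 2 * clip i x b') + Real.exp (4 * Real.log 2 * clip i x d')))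
      ≤ 93 / 100 / M * (Real.exp (4 * Real.log 2 * clip i x a')
        + Real.exp (4 * Real.log 2 * clip i x b')
        + Real.exp (4 * Real.log 2 * clip i x d')) ^ 2 := by
  have hM0 : (0 : ℝ) < M := by linarith [(by norm_num : (0 : ℝ) < 10 ^ 9)]
  obtain ⟨K, hK, hW⟩ := exp_clip_bounds i
  have hRb := exp_sub_one_mul_exp_le hM
  set R := Real.exp (4 * Real.log 2 * (1 / M)) with hR
  obtain ⟨la, ua⟩ := hW x a'
  obtain ⟨lb, ub⟩ := hW x b'
  obtain ⟨ld, ud⟩ := hW x d'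
  have hC := centre_mul_le i h1 h2 h3
  have hCs := sum_centre i
  rw [hsum] at hCs
  have hca := centre_pos i a'
  have hcb := centre_pos i b'
  have hcd := centre_pos i d'
  have hpa := Real.exp_pos (4 * Real.log 2 * clip i x a')
  have hpb := Real.exp_pos (4 * Real.log 2 * clip i x b')
  have hpd := Real.exp_pos (4 * Real.log 2 * clip i x d')
  set Wa := Real.exp (4 * Real.log 2 * clip i x a')
  set Wb := Real.exp (4 * Real.log 2 * clip i x b')
  set Wd := Real.exp (4 * Real.log 2 * clip i x d')
  have hZ : K * (1 - 1 / 10 ^ 5) ≤ Wa + Wb + Wd := by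
    calc K * (1 - 1 / 10 ^ 5) = K * (centre i a' + centre i b' + centre i d') * (1 - 1 / 10 ^ 5) := by
          rw [hCs, mul_one]
      _ = K * centre i a' * (1 - 1 / 10 ^ 5) + K * centre i b' * (1 - 1 / 10 ^ 5)
          + K * centre i d' * (1 - 1 / 10 ^ 5) := by ring
      _ ≤ _ := by linarith
  have hprod : Wa * (2 * Wb + Wd) ≤ K ^ 2 * (1 + 1 / 10 ^ 5) ^ 2 * (1 / 3) := by
    calc Wa * (2 * Wb + Wd) ≤ (K * centre i a' * (1 + 1 / 10 ^ 5)) *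
          (2 * (K * centre i b' * (1 + 1 / 10 ^ 5)) + K * centre i d' * (1 + 1 / 10 ^ 5)) := by
          gcongr
      _ = K ^ 2 * (1 + 1 / 10 ^ 5) ^ 2 * (centre i a' * (2 * centre i b' + centre i d')) := by ring
      _ ≤ _ := by gcongr
  calc (R - 1) * R * (Wa * (2 * Wb + Wd))
      ≤ (2.774 / M) * (K ^ 2 * (1 + 1 / 10 ^ 5) ^ 2 * (1 / 3)) := by
        gcongr
    _ = (2.774 * (1 + 1 / 10 ^ 5) ^ 2 * (1 / 3)) * (K ^ 2 / M) := by ring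
    -- The decisive numerical inequality: `4 log 2 / 3` is about `0.9242`, which leaves room below
    -- `0.93` for the errors of clipping and discretisation.
    _ ≤ (93 / 100 * (1 - 1 / 10 ^ 5) ^ 2) * (K ^ 2 / M) := by
        refine mul_le_mul_of_nonneg_right (by norm_num) (by positivity)
    _ = 93 / 100 / M * (K * (1 - 1 / 10 ^ 5)) ^ 2 := by ring
    _ ≤ _ := by
        have : 0 ≤ K * (1 - 1 / 10 ^ 5) := by
          refine mul_nonneg hK.le (by norm_num)
        gcongr

lemma clippedProb_update_sub (hM : (10 : ℝ) ^ 9 ≤ M) (i : Fin 4) (σ : Config M) {v w : Fin M}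
    (hv : v ≠ w) {a : Fin 3} (hab : a ≠ σ w) :
    0 ≤ clippedProb i (Function.update σ w a) v a - clippedProb i σ v a ∧
    clippedProb i (Function.update σ w a) v a - clippedProb i σ v a ≤ 93 / 100 / M ∧
    clippedProb i (Function.update σ w a) v (σ w) - clippedProb i σ v (σ w) ≤ 0 ∧
    clippedProb i σ v (σ w) - clippedProb i (Function.update σ w a) v (σ w) ≤ 93 / 100 / M := by
  have hM0 : (0 : ℝ) < M := by linarith [(by norm_num : (0 : ℝ) < 10 ^ 9)]
  have hL : 0 < Real.log 2 := Real.log_pos (by norm_num)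
  have hR1 : 1 ≤ Real.exp (4 * Real.log 2 * (1 / M)) := Real.one_le_exp (by positivity)
  set b := σ w with hb
  set σ' := Function.update σ w a with hσ'
  set x := othersRatio σ v with hx
  set x' := othersRatio σ' v with hx'
  have hxx : ∀ c, x' c = x c + ((if a = c then 1 / (M : ℝ) else 0)
      - if b = c then 1 / (M : ℝ) else 0) := fun c => othersRatio_update_of_ne σ hv a c
  obtain ⟨d, hda, hdb, hsum⟩ := exists_third hab
  have hxa : x' a = x a + 1 / M := by rw [hxx]; simp [Ne.symm hab]
  have hxb : x' b = x b - 1 / M := by rw [hxx]; simp [hab]; ring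
  have hxd : x' d = x d := by rw [hxx]; simp [hda.symm, hdb.symm]
  have hM1 : 0 ≤ 1 / (M : ℝ) := by positivity
  have expR : ∀ {s t : ℝ}, t ≤ s + 1 / M →
      Real.exp (4 * Real.log 2 * t) ≤ Real.exp (4 * Real.log 2 * (1 / M)) * Real.exp (4 * Real.log 2 * s) := by
    intro s t hst
    rw [← Real.exp_add]
    refine Real.exp_le_exp.2 ?_
    nlinarith
  have expm : ∀ {s t : ℝ}, s ≤ t →
      Real.exp (4 * Real.log 2 * s) ≤ Real.exp (4 * Real.log 2 * t) := by
    intro s t hst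
    exact Real.exp_le_exp.2 (by nlinarith)
  have a1 := expm (clip_mono_apply i (c := a) (x := x) (y := x') (by linarith))
  have a2 := expR (clip_add_le i (c := a) (x := x) (y := x') hM1 hxa.le)
  have b1 := expm (clip_mono_apply i (c := b) (x := x') (y := x) (by linarith))
  have b2 := expR (clip_add_le i (c := b) (x := x') (y := x) hM1 (by linarith))
  have d1 : clip i x' d = clip i x d := by rw [clip, clip, hxd]
  have θ1 := clip_weights_le hM i x hab hda hdb hsum
  -- The loss of colour `b` from `σ` to `σ'` is its gain from `σ'` to `σ`, so the same estimate
  -- applies with the roles exchanged.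
  have θ2 := clip_weights_le hM i x' (Ne.symm hab) hdb hda fun f => by rw [hsum]; ring
  set p := clippedProb i σ v with hp
  set p' := clippedProb i σ' v with hp'
  have pe : ∀ c, p c = Real.exp (4 * Real.log 2 * clip i x c) /
      (Real.exp (4 * Real.log 2 * clip i x a) + Real.exp (4 * Real.log 2 * clip i x b)
        + Real.exp (4 * Real.log 2 * clip i x d)) := fun c => by
    rw [← hsum fun c => Real.exp (4 * Real.log 2 * clip i x c)]; rfl
  have pe' : ∀ c, p' c = Real.exp (4 * Real.log 2 * clip i x' c) /
      (Real.exp (4 * Real.log 2 * clip i x' a) + Real.exp (4 * Real.log 2 * clip i x' b)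
        + Real.exp (4 * Real.log 2 * clip i x' d)) := fun c => by
    rw [← hsum fun c => Real.exp (4 * Real.log 2 * clip i x' c)]; rfl
  have hWa := Real.exp_pos (4 * Real.log 2 * clip i x a)
  have hWb := Real.exp_pos (4 * Real.log 2 * clip i x b)
  have hWd := Real.exp_pos (4 * Real.log 2 * clip i x d)
  have hWa' := Real.exp_pos (4 * Real.log 2 * clip i x' a)
  have hWb' := Real.exp_pos (4 * Real.log 2 * clip i x' b)
  have D1 : p' a - p a ≤ 93 / 100 / M := by
    rw [pe, pe', d1]
    exact div_sub_div_le hWa hWb hWd hR1 a1 a2 b1 b2 θ1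
  have D2 : p b - p' b ≤ 93 / 100 / M := by
    rw [pe, pe', ← d1]
    rw [add_comm (Real.exp (4 * Real.log 2 * clip i x a)),
      add_comm (Real.exp (4 * Real.log 2 * clip i x' a))]
    rw [← d1] at hWd
    exact div_sub_div_le hWb' hWa' hWd hR1 b1 b2 a1 a2 θ2
  have D3 : 0 ≤ p' a - p a := by
    rw [pe, pe', d1, sub_nonneg, div_le_div_iff₀ (by positivity) (by positivity)]
    have := mul_le_mul a1 (add_le_add_left b1 (Real.exp (4 * Real.log 2 * clip i x d)))
      (by positivity) hWa'.le
    linarith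
  have D4 : p' b - p b ≤ 0 := by
    rw [pe, pe', d1, sub_nonpos, div_le_div_iff₀ (by positivity) (by positivity)]
    have := mul_le_mul b1 (add_le_add_left a1 (Real.exp (4 * Real.log 2 * clip i x d)))
      (by positivity) hWb.le
    linarith
  exact ⟨D3, D1, D4, D2⟩

/-- `h` changes by at most `α` when one spin is changed. -/
def HasOscillation (α : ℝ) (h : Config M → ℝ) : Prop :=
  ∀ σ w a, |h (Function.update σ w a) - h σ| ≤ α

lemma HasOscillation.abs_sub_le {α : ℝ} {h : Config M → ℝ} (hh : HasOscillation α h)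
    (σ τ : Config M) : |h τ - h σ| ≤ M * α := by
  classical
  have : ∀ s : Finset (Fin M), |h (s.piecewise τ σ) - h σ| ≤ s.card * α := by
    intro s
    induction s using Finset.induction_on with
    | empty => simp
    | insert v s hv ih =>
      rw [Finset.piecewise_insert, Finset.card_insert_of_notMem hv]
      have := (_root_.abs_sub_le _ (h (s.piecewise τ σ)) (h σ)).trans
        (add_le_add (hh (s.piecewise τ σ) v (τ v)) ih)
      push_cast
      linarith
  simpa using this Finset.univ

/-- The dual form of path coupling. Two configurations differing at `w` coalesce when `w` is chosen;
any other choice costs a factor of at most `1 + 0.93 / M`. On average this is at most `(1 - 1 / M) *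
(1 + 0.93 / M) ≤ 1 - 0.07 / M`. -/
lemma HasOscillation.resample_clippedProb {α : ℝ} {h : Config M → ℝ} (hh : HasOscillation α h)
    (hM : (10 : ℝ) ^ 9 ≤ M) (i : Fin 4) :
    HasOscillation (α * (1 - 7 / 100 / M)) (resample (clippedProb i) h) := by
  intro σ w a
  have hM0 : (0 : ℝ) < M := by linarith [(by norm_num : (0 : ℝ) < 10 ^ 9)]
  have hα : 0 ≤ α := (abs_nonneg _).trans (hh σ w a)
  have h1M : 1 / (M : ℝ) ≤ 1 / 10 ^ 9 := one_div_le_one_div_of_le (by norm_num) hM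
  have hcontr : 0 ≤ 1 - 7 / 100 / (M : ℝ) := by
    rw [div_eq_mul_one_div]; norm_num at h1M ⊢; linarith
  by_cases hab : a = σ w
  · rw [hab, Function.update_eq_self, sub_self, abs_zero]; positivity
  set b := σ w with hb
  set θ := 93 / 100 / (M : ℝ) with hθ
  set σ' := Function.update σ w a with hσ'
  have hterm : ∀ v, v ≠ w → |∑ c, clippedProb i σ' v c * h (Function.update σ' v c)
      - ∑ c, clippedProb i σ v c * h (Function.update σ v c)| ≤ α * (1 + θ) := by
    intro v hv
    set p := clippedProb i σ v with hp
    set p' := clippedProb i σ' v with hp'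
    obtain ⟨D3, D1, D4, D2⟩ := clippedProb_update_sub hM i σ hv hab
    have hD := abs_sum_mul_le (D := fun c => p' c - p c) (h := fun c => h (Function.update σ' v c))
      (α := α) (θ := θ) hab
      (by rw [Finset.sum_sub_distrib, hp, hp', clippedProb, clippedProb, sum_softmax, sum_softmax,
        sub_self]) D3 D1 D4 (by linarith) (fun c d => by
        have := hh (Function.update σ' v d) v c
        rwa [Function.update_idem] at this)
    have hE : |∑ c, p c * (h (Function.update σ' v c) - h (Function.update σ v c))| ≤ α := by
      refine (Finset.abs_sum_le_sum_abs _ _).trans ?_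
      calc ∑ c, |p c * (h (Function.update σ' v c) - h (Function.update σ v c))|
          ≤ ∑ c, p c * α := by
            refine Finset.sum_le_sum fun c _ => ?_
            have hpc : 0 < p c := softmax_pos _ c
            rw [abs_mul, abs_of_pos hpc]
            refine mul_le_mul_of_nonneg_left ?_ hpc.le
            rw [hσ', Function.update_comm hv.symm]
            exact hh _ _ _
        _ = α := by rw [← Finset.sum_mul, hp, clippedProb, sum_softmax, one_mul]
    have : ∑ c, p' c * h (Function.update σ' v c) - ∑ c, p c * h (Function.update σ v c)
        = ∑ c, (p' c - p c) * h (Function.update σ' v c)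
          + ∑ c, p c * (h (Function.update σ' v c) - h (Function.update σ v c)) := by
      rw [← Finset.sum_sub_distrib, ← Finset.sum_add_distrib]
      exact Finset.sum_congr rfl fun c _ => by ring
    rw [this]
    refine (abs_add_le _ _).trans ?_
    linarith
  -- The law of the new spin at `w` does not depend on the old one, so resampling `w` erases the
  -- discrepancy.
  have hsame : ∑ c, clippedProb i σ' w c * h (Function.update σ' w c)
      - ∑ c, clippedProb i σ w c * h (Function.update σ w c) = 0 := by
    rw [clippedProb, clippedProb, hσ', othersRatio_update_same]
    simp only [Function.update_idem, sub_self]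
  rw [resample, resample, ← mul_sub, ← Finset.sum_sub_distrib,
    ← Finset.add_sum_erase _ _ (Finset.mem_univ w), hsame, zero_add, abs_mul,
    abs_of_pos (by positivity)]
  have hsumle := (Finset.abs_sum_le_sum_abs (fun v => ∑ c, clippedProb i σ' v c *
    h (Function.update σ' v c) - ∑ c, clippedProb i σ v c * h (Function.update σ v c))
    (Finset.univ.erase w)).trans (Finset.sum_le_sum fun v hv =>
      hterm v (Finset.ne_of_mem_erase hv))
  rw [Finset.sum_const, Finset.card_erase_of_mem (Finset.mem_univ w), Finset.card_univ,
    Fintype.card_fin, nsmul_eq_mul, Nat.cast_sub (by have := w.pos; omega), Nat.cast_one] at hsumle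
  calc _ ≤ 1 / (M : ℝ) * (((M : ℝ) - 1) * (α * (1 + θ))) := by gcongr
    _ = α * (1 - 7 / 100 / M) - α * θ / M := by rw [hθ]; field_simp; ring
    _ ≤ _ := by
      have : 0 ≤ α * θ / M := by positivity
      linarith

/-- Exponential forgetting of the initial configuration for the clipped dynamics. -/
lemma abs_iterate_resample_sub_le (hM : (10 : ℝ) ^ 9 ≤ M) (i : Fin 4) {f : Config M → ℝ}
    (hf : ∀ τ, |f τ| ≤ 1) (k : ℕ) (σ τ : Config M) :
    |(resample (clippedProb i))^[k] f τ - (resample (clippedProb i))^[k] f σ|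
      ≤ 2 * M * (1 - 7 / 100 / M) ^ k := by
  have : HasOscillation (2 * (1 - 7 / 100 / M) ^ k) ((resample (clippedProb i))^[k] f) := by
    induction k with
    | zero =>
      intro σ w a
      have := abs_sub (f (Function.update σ w a)) (f σ)
      simp only [pow_zero, mul_one, Function.iterate_zero, id]
      linarith [hf σ, hf (Function.update σ w a)]
    | succ k ih =>
      rw [Function.iterate_succ_apply', pow_succ, ← mul_assoc]
      exact ih.resample_clippedProb hM i
  have := this.abs_sub_le σ τ
  linarith

/-! ### Confinement of the Glauber dynamics to the core -/

/-- A triangle around the centre, larger than the inner region. -/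
def core (M : ℕ) (i : Fin 4) : Set (Config M) :=
  {σ | ∀ c, centre i c - rho ≤ ratio σ c}

lemma ratio_le_of_mem_core {i : Fin 4} {σ : Config M} (hM : M ≠ 0) (h : σ ∈ core M i) (c : Fin 3) :
    ratio σ c ≤ centre i c + 2 * rho := by
  have h1 := sum_ratio hM σ
  have h2 := sum_centre i
  rw [Fin.sum_univ_three] at h1 h2
  have h3 := h 0
  have h4 := h 1
  have h5 := h 2
  fin_cases c <;> simp only [Fin.zero_eta, Fin.mk_one, Fin.reduceFinMk] <;> linarith

lemma othersRatio_bounds (σ : Config M) (v : Fin M) (c : Fin 3) :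
    ratio σ c - 1 / M ≤ othersRatio σ v c ∧ othersRatio σ v c ≤ ratio σ c := by
  have : 0 ≤ 1 / (M : ℝ) := by positivity
  rw [othersRatio]
  split_ifs <;> constructor <;> linarith

lemma sum_othersRatio (hM : M ≠ 0) (σ : Config M) (v : Fin M) :
    ∑ c, othersRatio σ v c = 1 - 1 / M := by
  simp only [othersRatio, Finset.sum_sub_distrib, sum_ratio hM]
  simp

lemma one_div_le_of_le (hM : (10 : ℝ) ^ 9 ≤ M) : 1 / (M : ℝ) ≤ 1 / 10 ^ 9 :=
  one_div_le_one_div_of_le (by norm_num) hM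

lemma ne_zero_of_le (hM : (10 : ℝ) ^ 9 ≤ M) : M ≠ 0 := by
  rintro rfl
  norm_num at hM

lemma abs_othersRatio_sub_le (hM : (10 : ℝ) ^ 9 ≤ M) {i : Fin 4} {σ : Config M}
    (h : σ ∈ core M i) (v : Fin M) (c : Fin 3) : |othersRatio σ v c - centre i c| ≤ 3 * rho := by
  have h1 := othersRatio_bounds σ v c
  have h2 := h c
  have h3 := ratio_le_of_mem_core (ne_zero_of_le hM) h c
  have h4 := one_div_le_of_le hM
  have h5 : rho = 1 / 10 ^ 6 := rfl
  rw [abs_le]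
  constructor <;> linarith

lemma clippedProb_eq_condProb (hM : (10 : ℝ) ^ 9 ≤ M) {i : Fin 4} {σ : Config M}
    (h : σ ∈ core M i) (v : Fin M) :
    clippedProb i σ v = condProb (gibbs criticalBeta M) σ v := by
  rw [condProb_gibbs (ne_zero_of_le hM), clippedProb,
    clip_eq_self (abs_othersRatio_sub_le hM h v)]

/-- Softmax maps the core triangle strictly into itself. To first order in the shifts `w` of the
exponents, whose sum is nearly zero and which are at least about `-4 log 2 * rho`, a colour
probability drops by at most `4 log 2 * rho / 3`, about `0.924 * rho`, below its centre. The
constant `94/100` absorbs the remainder and the `1 / M` correction. -/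
lemma le_condProb (hM : (10 : ℝ) ^ 9 ≤ M) {i : Fin 4} {σ : Config M}
    (h : σ ∈ core M i) (v : Fin M) (c : Fin 3) :
    centre i c - 94 / 100 * rho ≤ condProb (gibbs criticalBeta M) σ v c := by
  rw [condProb_gibbs (ne_zero_of_le hM)]
  obtain ⟨K, hK, hKe⟩ := exp_mul_centre i
  have hL : 0 < Real.log 2 := Real.log_pos (by norm_num)
  have hL4 := four_mul_log_two_lt
  have h1M := one_div_le_of_le hM
  have h1M0 : 0 ≤ 1 / (M : ℝ) := by positivity
  set y := othersRatio σ v with hy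
  set w : Fin 3 → ℝ := fun b => 4 * Real.log 2 * (y b - centre i b) with hw
  have hr : rho = 1 / 10 ^ 6 := rfl
  have hwl : ∀ b, -(2776 / 10 ^ 9) ≤ w b := by
    intro b
    have h1 := (othersRatio_bounds σ v b).1
    have h2 := h b
    have : -(1001 / 10 ^ 9) ≤ y b - centre i b := by rw [hr] at h2; linarith
    rw [hw]
    nlinarith
  have hws : ∑ b, w b = - (4 * Real.log 2 * (1 / M)) := by
    simp only [hw, ← Finset.mul_sum, Finset.sum_sub_distrib, hy,
      sum_othersRatio (ne_zero_of_le hM), sum_centre]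
    ring
  have hws0 : -(3 / 10 ^ 9) ≤ ∑ b, w b := by rw [hws]; nlinarith
  have hws1 : ∑ b, w b ≤ 0 := by rw [hws]; nlinarith
  have hwu : ∀ b, |w b| ≤ 9 / 10 ^ 6 := by
    intro b
    have := abs_othersRatio_sub_le hM h v b
    rw [hw, abs_mul, abs_of_pos (by positivity)]
    rw [hr] at this
    nlinarith [abs_nonneg (othersRatio σ v b - centre i b)]
  have hel : ∀ b, 1 + w b ≤ Real.exp (w b) := fun b => by
    rw [add_comm]; exact Real.add_one_le_exp _
  have heu : ∀ b, Real.exp (w b) ≤ 1 + w b + 1 / 10 ^ 10 := by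
    intro b
    have h1 := hwu b
    have hq := (abs_le.1 (Real.abs_exp_sub_one_sub_id_le (x := w b)
      (by norm_num at h1 ⊢; linarith))).2
    have : w b ^ 2 ≤ (9 / 10 ^ 6) ^ 2 := by
      rw [← sq_abs]; exact pow_le_pow_left₀ (abs_nonneg _) h1 2
    linarith
  have hW : ∀ b, Real.exp (4 * Real.log 2 * y b) = K * (centre i b * Real.exp (w b)) := by
    intro b
    rw [← mul_assoc, ← hKe, ← Real.exp_add]
    congr 1
    simp only [hw]
    ring
  rw [softmax, le_div_iff₀ (sum_exp_pos y)]
  simp only [hW]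
  rw [← Finset.mul_sum, mul_left_comm]
  refine mul_le_mul_of_nonneg_left ?_ hK.le
  have l0 := hel 0
  have l1 := hel 1
  have l2 := hel 2
  have u0 := heu 0
  have u1 := heu 1
  have u2 := heu 2
  have m0 := hwl 0
  have m1 := hwl 1
  have m2 := hwl 2
  rw [Fin.sum_univ_three] at hws0 hws1 ⊢
  rw [hr]
  fin_cases i <;> fin_cases c <;> simp [centre] <;> linarith

/-- The base of the exponential Lyapunov function. -/
def lyapBase : ℝ := 1 + rho / 100

/-- The exponential Lyapunov function controlling the exit from the core. -/
def lyap (i : Fin 4) (c : Fin 3) (σ : Config M) : ℝ :=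
  Real.exp (Real.log lyapBase * (M * (centre i c - rho - ratio σ c)))

/-- The rate of the exit probability from the core. -/
def exitRate : ℝ := Real.log lyapBase * (3 / 100 * rho)

lemma one_lt_lyapBase : 1 < lyapBase := by norm_num [lyapBase, rho]

lemma exitRate_pos : 0 < exitRate :=
  mul_pos (Real.log_pos one_lt_lyapBase) (by norm_num [rho])

lemma condProb_nonneg (hM : M ≠ 0) (σ : Config M) (v : Fin M) (c : Fin 3) :
    0 ≤ condProb (gibbs criticalBeta M) σ v c := by
  rw [condProb_gibbs hM]; exact (softmax_pos _ c).le

lemma sum_condProb (hM : M ≠ 0) (σ : Config M) (v : Fin M) :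
    ∑ c, condProb (gibbs criticalBeta M) σ v c = 1 := by
  rw [condProb_gibbs hM]; exact sum_softmax _

lemma lyap_update (hM : M ≠ 0) (i : Fin 4) (c : Fin 3) (σ : Config M) (v : Fin M) (b : Fin 3) :
    lyap i c (Function.update σ v b)
      = lyap i c σ * ((if σ v = c then lyapBase else 1) * if b = c then lyapBase⁻¹ else 1) := by
  have hM' : (M : ℝ) ≠ 0 := by exact_mod_cast hM
  have ha : 0 < lyapBase := one_pos.trans one_lt_lyapBase
  have h1 : (if σ v = c then lyapBase else 1)
      = Real.exp (Real.log lyapBase * if σ v = c then 1 else 0) := by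
    split_ifs <;> simp [Real.exp_log ha]
  have h2 : (if b = c then lyapBase⁻¹ else 1)
      = Real.exp (-(Real.log lyapBase * if b = c then 1 else 0)) := by
    split_ifs <;> simp [Real.exp_log ha, Real.exp_neg]
  rw [h1, h2, lyap, lyap, ratio_update, othersRatio, ← Real.exp_add, ← Real.exp_add]
  congr 1
  split_ifs <;> field_simp <;> ring

/-- In the outer layer of the core, where the ratio is at most `centre i c - 0.97 * rho`, colour `c`
is drawn with probability at least `centre i c - 0.94 * rho`. The ratio drifts back up and `lyap`
does not increase on average. Elsewhere `lyap` is at most `exp (-(exitRate * M))`, and one move at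
most doubles it. -/
lemma resample_lyap_le (hM : (10 : ℝ) ^ 9 ≤ M) {i : Fin 4} {σ : Config M}
    (h : σ ∈ core M i) (c : Fin 3) :
    resample (condProb (gibbs criticalBeta M)) (lyap i c) σ
      ≤ lyap i c σ + 2 * Real.exp (-(exitRate * M)) := by
  have hM0 : (0 : ℝ) < M := by linarith [(by norm_num : (0 : ℝ) < 10 ^ 9)]
  have hMn := ne_zero_of_le hM
  have ha1 := one_lt_lyapBase
  have ha : 0 < lyapBase := one_pos.trans ha1
  have hV : 0 < lyap i c σ := Real.exp_pos _
  have hr : rho = 1 / 10 ^ 6 := rfl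
  have hlog := Real.log_pos ha1
  by_cases hs : ratio σ c ≤ centre i c - 97 / 100 * rho
  · refine le_trans ?_ (le_add_of_nonneg_right (by positivity))
    set q := centre i c - 94 / 100 * rho with hq
    set a := lyapBase with hadef
    have hterm : ∀ v, ∑ b, condProb (gibbs criticalBeta M) σ v b * lyap i c (Function.update σ v b)
        ≤ lyap i c σ * ((if σ v = c then (1 : ℝ) else 0) * ((a - 1) * (1 - q) + (1 - a⁻¹) * q)
          + (1 - (1 - a⁻¹) * q)) := by
      intro v
      have hp := le_condProb hM h v c
      rw [← hq] at hp
      have hsum := sum_condProb hMn σ v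
      set p := condProb (gibbs criticalBeta M) σ v
      have e1 : ∑ b, p b * lyap i c (Function.update σ v b)
          = lyap i c σ * ((if σ v = c then a else 1) * (1 - p c * (1 - a⁻¹))) := by
        have : ∀ b, p b * lyap i c (Function.update σ v b)
            = lyap i c σ * (if σ v = c then a else 1) *
              (p b - if b = c then p b * (1 - a⁻¹) else 0) := by
          intro b
          rw [lyap_update hMn]
          split_ifs <;> ring
        simp only [this]
        rw [← Finset.mul_sum, Finset.sum_sub_distrib, hsum]
        simp [mul_assoc]
      rw [e1]
      refine mul_le_mul_of_nonneg_left ?_ hV.le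
      have hai : a * a⁻¹ = 1 := mul_inv_cancel₀ ha.ne'
      have hai1 : a⁻¹ ≤ 1 := inv_le_one_of_one_le₀ ha1.le
      split_ifs
      · have : (a - 1) * q ≤ (a - 1) * p c := mul_le_mul_of_nonneg_left hp (by linarith)
        have e2 : a * (1 - p c * (1 - a⁻¹)) = a - p c * (a - 1) := by
          linear_combination p c * hai
        rw [e2]
        linarith
      · have : (1 - a⁻¹) * q ≤ (1 - a⁻¹) * p c := mul_le_mul_of_nonneg_left hp (by linarith)
        linarith
    have hsum := Finset.sum_le_sum fun v (_ : v ∈ Finset.univ) => hterm v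
    rw [← Finset.mul_sum, Finset.sum_add_distrib, ← Finset.sum_mul, sum_ite_ratio hMn,
      Finset.sum_const, Finset.card_univ, Fintype.card_fin, nsmul_eq_mul] at hsum
    rw [resample, one_div, inv_mul_le_iff₀ hM0]
    refine hsum.trans ?_
    set s := ratio σ c with hsdef
    have hfin : s * ((a - 1) * (1 - q) + (1 - a⁻¹) * q) + (1 - (1 - a⁻¹) * q) ≤ 1 := by
      have hs0 : 0 ≤ s := ratio_nonneg σ c
      have hc1 : centre i c ≤ 1 := by
        rw [← sum_centre i]
        exact Finset.single_le_sum (fun b _ => (centre_pos i b).le) (Finset.mem_univ c)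
      have hc0 : 1 / 6 ≤ centre i c := by
        fin_cases i <;> fin_cases c <;> simp [centre] <;> norm_num
      have haeq : a - 1 = 1 / 10 ^ 8 := by rw [hadef, lyapBase, hr]; norm_num
      -- The drift margin `q - s ≥ 0.03 * rho` dominates the second-order effect of the exponential,
      -- at most `a - 1 = rho / 100`; this is why `lyapBase` is so close to one.
      have hmain : a * s * (1 - q) ≤ (1 - s) * q := by
        have e : a * s * (1 - q) - (1 - s) * q = (s - q) + (a - 1) * (s * (1 - q)) := by ring
        have hsq : s * (1 - q) ≤ 1 * 1 := by
          refine mul_le_mul ?_ ?_ ?_ ?_ <;> rw [hr] at * <;> linarith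
        rw [haeq] at e
        rw [hr] at *
        linarith
      have hai : a * a⁻¹ = 1 := mul_inv_cancel₀ ha.ne'
      have h2 : a * (1 - a⁻¹) = a - 1 := by linear_combination -hai
      have h3 : 0 ≤ 1 - a⁻¹ := sub_nonneg.2 (inv_le_one_of_one_le₀ ha1.le)
      have h4 := mul_le_mul_of_nonneg_left hmain h3
      have h5 : (1 - a⁻¹) * (a * s * (1 - q)) = s * ((a - 1) * (1 - q)) := by
        rw [← h2]; ring
      rw [h5] at h4
      linarith
    calc lyap i c σ * (M * s * ((a - 1) * (1 - q) + (1 - a⁻¹) * q) + M * (1 - (1 - a⁻¹) * q))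
        = M * lyap i c σ * (s * ((a - 1) * (1 - q) + (1 - a⁻¹) * q) + (1 - (1 - a⁻¹) * q)) := by
          ring
      _ ≤ M * lyap i c σ * 1 := by gcongr
      _ = _ := mul_one _
  · push Not at hs
    refine le_trans ?_ (le_add_of_nonneg_left hV.le)
    refine resample_le_of_forall hMn (condProb_nonneg hMn) (sum_condProb hMn) fun v b => ?_
    rw [lyap_update hMn, mul_comm]
    have h2 : lyapBase ≤ 2 := by norm_num [lyapBase, rho]
    have hg : ((if σ v = c then lyapBase else 1) * if b = c then lyapBase⁻¹ else 1) ≤ 2 := by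
      have hai1 : lyapBase⁻¹ ≤ 1 := inv_le_one_of_one_le₀ ha1.le
      have hai : lyapBase * lyapBase⁻¹ = 1 := mul_inv_cancel₀ ha.ne'
      split_ifs <;> linarith
    refine mul_le_mul hg ?_ hV.le (by norm_num)
    refine Real.exp_le_exp.2 ?_
    rw [exitRate]
    have : M * (centre i c - rho - ratio σ c) ≤ M * (-(3 / 100 * rho)) :=
      mul_le_mul_of_nonneg_left (by linarith) hM0.le
    calc Real.log lyapBase * (M * (centre i c - rho - ratio σ c))
        ≤ Real.log lyapBase * (M * (-(3 / 100 * rho))) := mul_le_mul_of_nonneg_left this hlog.le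
      _ = _ := by ring

lemma one_le_sum_lyap {i : Fin 4} {σ : Config M} (h : σ ∉ core M i) : 1 ≤ ∑ c, lyap i c σ := by
  simp only [core, Set.mem_ofPred_eq, not_forall, not_le] at h
  obtain ⟨c, hc⟩ := h
  have h1 : 1 ≤ lyap i c σ := Real.one_le_exp (mul_nonneg (Real.log_pos one_lt_lyapBase).le
    (mul_nonneg (Nat.cast_nonneg _) (by linarith)))
  exact h1.trans (Finset.single_le_sum (f := fun c => lyap i c σ)
    (fun b _ => (Real.exp_pos _).le) (Finset.mem_univ c))

lemma sum_lyap_le {i : Fin 4} {σ : Config M} (h : σ ∈ innerRegion M i) :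
    ∑ c, lyap i c σ ≤ 3 * Real.exp (-(exitRate * M)) := by
  have : ∀ c, lyap i c σ ≤ Real.exp (-(exitRate * M)) := by
    intro c
    have h1 := (h c).1
    have hr : 0 < rho := by norm_num [rho]
    refine Real.exp_le_exp.2 ?_
    have : M * (centre i c - rho - ratio σ c) ≤ M * (-(3 / 100 * rho)) :=
      mul_le_mul_of_nonneg_left (by linarith) (Nat.cast_nonneg _)
    calc Real.log lyapBase * (M * (centre i c - rho - ratio σ c))
        ≤ Real.log lyapBase * (M * (-(3 / 100 * rho))) :=
          mul_le_mul_of_nonneg_left this (Real.log_pos one_lt_lyapBase).le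
      _ = _ := by rw [exitRate]; ring
  calc ∑ c, lyap i c σ ≤ ∑ _c : Fin 3, Real.exp (-(exitRate * M)) :=
        Finset.sum_le_sum fun c _ => this c
    _ = _ := by simp

lemma resample_congr {q q' : Config M → Fin M → Fin 3 → ℝ} {σ : Config M} (h : ∀ v, q σ v = q' σ v)
    (f : Config M → ℝ) : resample q f σ = resample q' f σ := by
  simp only [resample, h]

/-- The Glauber dynamics and its clipped version agree until they leave the core. -/
lemma abs_iterate_sub_iterate_le (hM : (10 : ℝ) ^ 9 ≤ M) (i : Fin 4) {f : Config M → ℝ}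
    (hf : ∀ τ, |f τ| ≤ 1) (k : ℕ) :
    ∀ σ, |(resample (condProb (gibbs criticalBeta M)))^[k] f σ
        - (resample (clippedProb i))^[k] f σ|
      ≤ 2 * (∑ c, lyap i c σ + k * (6 * Real.exp (-(exitRate * M)))) := by
  have hMn := ne_zero_of_le hM
  induction k with
  | zero =>
    intro σ
    simp only [Function.iterate_zero, id, sub_self, abs_zero, Nat.cast_zero, zero_mul, add_zero]
    exact mul_nonneg (by norm_num) (Finset.sum_nonneg fun c _ => (Real.exp_pos _).le)
  | succ k ih =>
    intro σ
    by_cases hσ : σ ∈ core M i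
    -- On the core both kernels coincide at `σ`, so the error after `k + 1` steps is the true
    -- dynamics applied to the error after `k` steps, and the Lyapunov bound propagates.
    · rw [Function.iterate_succ_apply', Function.iterate_succ_apply',
        resample_congr (fun v => clippedProb_eq_condProb hM hσ v), ← resample_sub]
      refine (abs_resample_le (condProb_nonneg hMn) ih).trans ?_
      rw [resample_const_mul, resample_add, resample_const hMn (sum_condProb hMn)]
      refine mul_le_mul_of_nonneg_left ?_ (by norm_num)
      have hsum : resample (condProb (gibbs criticalBeta M)) (fun τ => ∑ c, lyap i c τ) σ
          ≤ ∑ c, lyap i c σ + 6 * Real.exp (-(exitRate * M)) := by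
        simp only [Fin.sum_univ_three]
        rw [resample_add, resample_add]
        linarith [resample_lyap_le hM hσ 0, resample_lyap_le hM hσ 1, resample_lyap_le hM hσ 2]
      push_cast
      linarith
    -- Outside the core the trivial bound `2` is already below `2 * ∑ c, lyap i c σ`.
    · have h1 := one_le_sum_lyap hσ
      have b1 := abs_iterate_resample_le hMn (condProb_nonneg hMn) (sum_condProb hMn) hf (k + 1) σ
      have b2 := abs_iterate_resample_le (q := clippedProb i) hMn
        (fun σ v c => (softmax_pos _ c).le) (fun σ v => sum_softmax _) hf (k + 1) σ
      have h3 : 0 ≤ ((k + 1 : ℕ) : ℝ) * (6 * Real.exp (-(exitRate * M))) := by positivity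
      have := abs_sub ((resample (condProb (gibbs criticalBeta M)))^[k + 1] f σ)
        ((resample (clippedProb i))^[k + 1] f σ)
      linarith

/-! ### Near-stationarity of the restricted Gibbs measure -/

/-- Exchanging the old and the new colour at `v` is an involution on pairs of a configuration and a
colour; this is the combinatorial content of detailed balance. -/
lemma sum_update_swap (v : Fin M) (G : Config M → Config M → ℝ) :
    ∑ σ, ∑ c, G σ (Function.update σ v c) = ∑ σ, ∑ c, G (Function.update σ v c) σ := by
  rw [← Fintype.sum_prod_type' (f := fun σ c => G σ (Function.update σ v c)),
    ← Fintype.sum_prod_type' (f := fun σ c => G (Function.update σ v c) σ)]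
  have hinv : Function.Involutive
      (fun x : Config M × Fin 3 => (Function.update x.1 v x.2, x.1 v)) := by
    rintro ⟨σ, c⟩
    simp
  rw [← Equiv.sum_comp hinv.toPerm]
  simp [Function.Involutive.toPerm]

/-- The Glauber dynamics is reversible. -/
lemma sum_mul_resample (μ g h : Config M → ℝ) :
    ∑ σ, μ σ * (g σ * resample (condProb μ) h σ)
      = ∑ σ, μ σ * (h σ * resample (condProb μ) g σ) := by
  have key : ∀ g h : Config M → ℝ, ∑ σ, μ σ * (g σ * resample (condProb μ) h σ)
      = 1 / (M : ℝ) * ∑ v, ∑ σ, ∑ c, μ σ * (g σ * (condProb μ σ v c * h (Function.update σ v c))) := by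
    intro g h
    rw [Finset.sum_comm, Finset.mul_sum]
    refine Finset.sum_congr rfl fun σ _ => ?_
    simp only [resample, Finset.mul_sum]
    refine Finset.sum_congr rfl fun v _ => Finset.sum_congr rfl fun c _ => ?_
    ring
  rw [key, key]
  congr 1
  refine Finset.sum_congr rfl fun v _ => ?_
  have := sum_update_swap v fun σ τ =>
    μ σ * (g σ * (μ τ / (∑ b, μ (Function.update σ v b)) * h τ))
  simp only [condProb]
  rw [this]
  refine Finset.sum_congr rfl fun σ _ => Finset.sum_congr rfl fun c _ => ?_
  simp only [Function.update_idem]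
  ring

lemma gibbs_pos (M : ℕ) (σ : Config M) : 0 < gibbs criticalBeta M σ :=
  div_pos (Real.exp_pos _) (sum_weight_pos _ _)

open scoped Classical in
/-- A restricted Gibbs measure is stationary up to the mass outside a set which cannot be left
from inside in one step. -/
lemma abs_sum_mul_resample_sub_le (hM : M ≠ 0) {F U : Set (Config M)}
    (hUF : ∀ σ ∈ U, σ ∈ F ∧ ∀ v c, Function.update σ v c ∈ F) {f : Config M → ℝ}
    (hf : ∀ τ, |f τ| ≤ 1) :
    |∑ σ, (if σ ∈ F then gibbs criticalBeta M σ else 0) *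
        resample (condProb (gibbs criticalBeta M)) f σ
      - ∑ σ, (if σ ∈ F then gibbs criticalBeta M σ else 0) * f σ|
      ≤ 2 * ∑ σ, if σ ∈ F \ U then gibbs criticalBeta M σ else 0 := by
  set μ := gibbs criticalBeta M with hμ
  set P := resample (condProb μ) with hP
  set I : Config M → ℝ := fun σ => if σ ∈ F then 1 else 0 with hI
  have hI0 : ∀ σ, 0 ≤ I σ := fun σ => by simp only [hI]; split_ifs <;> norm_num
  have hI1 : ∀ σ, I σ ≤ 1 := fun σ => by simp only [hI]; split_ifs <;> norm_num
  have hPI0 : ∀ σ, 0 ≤ P I σ := fun σ => by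
    rw [← resample_const hM (sum_condProb hM) 0 σ]
    exact resample_mono (condProb_nonneg hM) hI0
  have hPI1 : ∀ σ, P I σ ≤ 1 := fun σ =>
    resample_le_of_forall hM (condProb_nonneg hM) (sum_condProb hM) fun v c => hI1 _
  have hPIU : ∀ σ ∈ U, P I σ = 1 := by
    intro σ hσ
    have : P I σ = P (fun _ => 1) σ := by
      simp only [hP, resample, hI, (hUF σ hσ).2, if_true]
    rw [this, hP, resample_const hM (sum_condProb hM)]
  have e1 : ∑ σ, (if σ ∈ F then μ σ else 0) * P f σ = ∑ σ, μ σ * (f σ * P I σ) := by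
    rw [← sum_mul_resample μ I f]
    refine Finset.sum_congr rfl fun σ _ => ?_
    simp only [hI]; split_ifs <;> simp [hP]
  have e2 : ∑ σ, (if σ ∈ F then μ σ else 0) * f σ = ∑ σ, μ σ * (f σ * I σ) := by
    refine Finset.sum_congr rfl fun σ _ => ?_
    simp only [hI]; split_ifs <;> simp
  have e3 : ∑ σ, μ σ * P I σ = ∑ σ, μ σ * I σ := by
    have := sum_mul_resample μ (fun _ => 1) I
    simp only [one_mul] at this
    rw [hP, this]
    refine Finset.sum_congr rfl fun σ _ => ?_
    rw [resample_const hM (sum_condProb hM), mul_one]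
  -- By reversibility, the defect of stationarity is the integral of `f * (P I - I)`. The signed
  -- part of `|P I - I|` has mean zero under `μ`, and what is left is the flow out of `F`, which
  -- vanishes on `U`.
  have habs : ∀ σ, |P I σ - I σ| = (P I σ - I σ) + 2 * (I σ * (1 - P I σ)) := by
    intro σ
    simp only [hI]
    split_ifs
    · rw [abs_of_nonpos (by have := hPI1 σ; simp only [hI] at this; linarith)]; ring
    · rw [abs_of_nonneg (by have := hPI0 σ; simp only [hI] at this; linarith)]; ring
  rw [e1, e2, ← Finset.sum_sub_distrib]
  calc |∑ σ, (μ σ * (f σ * P I σ) - μ σ * (f σ * I σ))|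
      ≤ ∑ σ, |μ σ * (f σ * P I σ) - μ σ * (f σ * I σ)| := Finset.abs_sum_le_sum_abs _ _
    _ ≤ ∑ σ, ((μ σ * P I σ - μ σ * I σ) + 2 * (μ σ * (I σ * (1 - P I σ)))) := by
        refine Finset.sum_le_sum fun σ _ => ?_
        have hμ0 := (gibbs_pos M σ).le
        have : μ σ * (f σ * P I σ) - μ σ * (f σ * I σ) = μ σ * (f σ * (P I σ - I σ)) := by ring
        rw [this, abs_mul, abs_mul, abs_of_nonneg hμ0]
        have h1 : |f σ| * |P I σ - I σ| ≤ 1 * |P I σ - I σ| :=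
          mul_le_mul_of_nonneg_right (hf σ) (abs_nonneg _)
        rw [one_mul, habs] at h1
        rw [← habs] at h1
        have := mul_le_mul_of_nonneg_left h1 hμ0
        rw [habs] at this ⊢
        linarith
    _ = 2 * ∑ σ, μ σ * (I σ * (1 - P I σ)) := by
        rw [Finset.sum_add_distrib, Finset.sum_sub_distrib, e3, sub_self, zero_add, Finset.mul_sum]
    _ ≤ _ := by
        refine mul_le_mul_of_nonneg_left (Finset.sum_le_sum fun σ _ => ?_) (by norm_num)
        have hμ0 := (gibbs_pos M σ).le
        by_cases hF : σ ∈ F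
        · by_cases hU : σ ∈ U
          · simp [hPIU σ hU, hU]
          · simp only [hI, hF, hU, Set.mem_sdiff, not_false_eq_true, and_self, if_true, one_mul]
            exact mul_le_of_le_one_right hμ0 (by have := hPI0 σ; simp only [hI] at this; linarith)
        · simp [hI, hF]

open scoped Classical in
lemma abs_sum_mul_iterate_clipped_sub_le (hM : (10 : ℝ) ^ 9 ≤ M) {i : Fin 4} {F : Set (Config M)}
    (hUF : ∀ σ ∈ core M i, σ ∈ F ∧ ∀ v c, Function.update σ v c ∈ F) {f : Config M → ℝ}
    (hf : ∀ τ, |f τ| ≤ 1) (k : ℕ) :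
    |∑ σ, (if σ ∈ F then gibbs criticalBeta M σ else 0) * (resample (clippedProb i))^[k] f σ
      - ∑ σ, (if σ ∈ F then gibbs criticalBeta M σ else 0) * f σ|
      ≤ 4 * k * ∑ σ, if σ ∈ F \ core M i then gibbs criticalBeta M σ else 0 := by
  have hMn := ne_zero_of_le hM
  induction k with
  | zero => simp
  | succ k ih =>
    set μ := gibbs criticalBeta M with hμ
    set g := (resample (clippedProb i))^[k] f with hg
    have hg1 : ∀ τ, |g τ| ≤ 1 := abs_iterate_resample_le (q := clippedProb i) hMn
        (fun σ v c => (softmax_pos _ c).le) (fun σ v => sum_softmax _) hf k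
    have h1 := abs_sum_mul_resample_sub_le hMn hUF hg1
    -- Each step costs twice the mass of `F` off the core for replacing the clipped kernel by the
    -- true one, and as much again for the defect of stationarity: hence the factor `4 * k`.
    have h2 : |∑ σ, (if σ ∈ F then μ σ else 0) * resample (clippedProb i) g σ
        - ∑ σ, (if σ ∈ F then μ σ else 0) * resample (condProb μ) g σ|
        ≤ 2 * ∑ σ, if σ ∈ F \ core M i then μ σ else 0 := by
      rw [← Finset.sum_sub_distrib, Finset.mul_sum]
      refine (Finset.abs_sum_le_sum_abs _ _).trans (Finset.sum_le_sum fun σ _ => ?_)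
      by_cases hF : σ ∈ F
      · by_cases hU : σ ∈ core M i
        · rw [resample_congr (fun v => clippedProb_eq_condProb hM hU v), ← hμ]
          simp [hU]
        · simp only [hF, hU, Set.mem_sdiff, not_false_eq_true, and_self, if_true]
          have hμ0 := (gibbs_pos M σ).le
          have b1 : |resample (condProb μ) g σ| ≤ 1 :=
            (abs_resample_le (condProb_nonneg hMn) hg1).trans
              (resample_const hMn (sum_condProb hMn) 1 σ).le
          have b2 : |resample (clippedProb i) g σ| ≤ 1 :=
            (abs_resample_le (fun σ v c => (softmax_pos _ c).le) hg1).trans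
              (resample_const hMn (fun σ v => sum_softmax _) 1 σ).le
          rw [← mul_sub, abs_mul, abs_of_nonneg hμ0, mul_comm]
          refine mul_le_mul_of_nonneg_right ?_ hμ0
          have := abs_sub (resample (clippedProb i) g σ) (resample (condProb μ) g σ)
          linarith
      · simp [hF]
    rw [Function.iterate_succ_apply']
    rw [abs_le] at *
    push_cast
    constructor <;> linarith [h1.1, h1.2, h2.1, h2.2, ih.1, ih.2]

/-! ### Concentration of the Gibbs measure on the cores -/

lemma sum_exp_linear (hM : M ≠ 0) (z : Fin 3 → ℝ) :
    ∑ σ : Config M, Real.exp (M * ∑ c, ratio σ c * z c) = (∑ c, Real.exp (z c)) ^ M := by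
  rw [Fintype.sum_pow]
  refine Finset.sum_congr rfl fun σ _ => ?_
  rw [← Real.exp_sum]
  congr 1
  have hM' : (M : ℝ) ≠ 0 := by exact_mod_cast hM
  simp only [ratio_eq_sum, Finset.mul_sum, div_mul_eq_mul_div, Finset.sum_mul,
    mul_div_cancel₀ _ hM']
  rw [Finset.sum_comm]
  simp

/-- The weight of the linearisation of the energy at `y`. -/
def linWeight (y : Fin 3 → ℝ) (σ : Config M) : ℝ :=
  Real.exp (M * ∑ c, ratio σ c * (4 * Real.log 2 * y c)) *
    Real.exp (-(M * (2 * Real.log 2 * ∑ c, y c ^ 2)))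

lemma sum_linWeight (hM : M ≠ 0) (y : Fin 3 → ℝ) :
    ∑ σ : Config M, linWeight y σ = Real.exp (M * dualEnergy y) := by
  simp only [linWeight]
  rw [← Finset.sum_mul, sum_exp_linear hM, dualEnergy, mul_sub, sub_eq_add_neg, Real.exp_add,
    Real.exp_nat_mul, Real.exp_log (sum_exp_pos y)]

lemma linWeight_ratio (σ : Config M) : linWeight (ratio σ) σ = weight criticalBeta σ := by
  rw [linWeight, weight, ← Real.exp_add, criticalBeta]
  congr 1
  simp only [Fin.sum_univ_three]
  ring

lemma linWeight_le (y : Fin 3 → ℝ) (σ : Config M) : linWeight y σ ≤ weight criticalBeta σ := by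
  rw [linWeight, weight, ← Real.exp_add, criticalBeta]
  refine Real.exp_le_exp.2 ?_
  have hL : 0 < Real.log 2 := Real.log_pos (by norm_num)
  have h : 0 ≤ M * (2 * Real.log 2) * ∑ c, (ratio σ c - y c) ^ 2 :=
    mul_nonneg (by positivity) (Finset.sum_nonneg fun c _ => sq_nonneg _)
  simp only [Fin.sum_univ_three] at h ⊢
  nlinarith

open scoped Classical in
/-- The total weight of a set of configurations in terms of the dual free energy. -/
lemma sum_weight_le (hM : M ≠ 0) (S : Set (Config M)) {m : ℝ}
    (hS : ∀ σ ∈ S, dualEnergy (ratio σ) ≤ m) :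
    ∑ σ, (if σ ∈ S then weight criticalBeta σ else 0) ≤ ((M : ℝ) + 1) ^ 3 * Real.exp (M * m) := by
  set T : Finset (Fin 3 → ℝ) := (Finset.univ : Finset (Fin 3 → Fin (M + 1))).image
    fun n c => ((n c : ℕ) : ℝ) / M with hT
  set T' := T.filter fun y => dualEnergy y ≤ m with hT'
  have hmem : ∀ σ : Config M, ratio σ ∈ T := by
    intro σ
    refine Finset.mem_image.2 ⟨fun c => ⟨(Finset.univ.filter fun l => σ l = c).card, ?_⟩,
      Finset.mem_univ _, rfl⟩
    have := Finset.card_le_univ (Finset.univ.filter fun l => σ l = c)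
    rw [Fintype.card_fin] at this
    omega
  have hcard : (T'.card : ℝ) ≤ ((M : ℝ) + 1) ^ 3 := by
    have h1 : T'.card ≤ (M + 1) ^ 3 := by
      refine (Finset.card_filter_le _ _).trans (Finset.card_image_le.trans ?_)
      simp
    exact_mod_cast h1
  have hpos : ∀ (y : Fin 3 → ℝ) (σ : Config M), 0 ≤ linWeight y σ := fun y σ =>
    mul_nonneg (Real.exp_pos _).le (Real.exp_pos _).le
  -- Each Gibbs weight is the term `y = ratio σ` of the sum over the grid; keeping all the other
  -- terms makes the sum over configurations factorise.
  calc ∑ σ, (if σ ∈ S then weight criticalBeta σ else 0)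
      ≤ ∑ σ : Config M, ∑ y ∈ T', linWeight y σ := by
        refine Finset.sum_le_sum fun σ _ => ?_
        split_ifs with h
        · rw [← linWeight_ratio]
          exact Finset.single_le_sum (f := fun y => linWeight y σ) (fun y _ => hpos y σ)
            (Finset.mem_filter.2 ⟨hmem σ, hS σ h⟩)
        · exact Finset.sum_nonneg fun y _ => hpos y σ
    _ = ∑ y ∈ T', Real.exp (M * dualEnergy y) := by
        rw [Finset.sum_comm]
        exact Finset.sum_congr rfl fun y _ => sum_linWeight hM y
    _ ≤ ∑ _y ∈ T', Real.exp (M * m) := by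
        refine Finset.sum_le_sum fun y hy => Real.exp_le_exp.2 ?_
        exact mul_le_mul_of_nonneg_left (Finset.mem_filter.1 hy).2 (Nat.cast_nonneg _)
    _ = T'.card * Real.exp (M * m) := by rw [Finset.sum_const, nsmul_eq_mul]
    _ ≤ _ := mul_le_mul_of_nonneg_right hcard (Real.exp_pos _).le

/-- A Chernoff bound for the product measure obtained by linearising at a centre. -/
lemma sum_linWeight_tilted_le (hM : M ≠ 0) (i : Fin 4) (c : Fin 3) :
    ∑ σ : Config M, linWeight (centre i) σ * Real.exp (M * (rho * (centre i c - rho - ratio σ c)))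
      ≤ Real.exp (M * maxEnergy) * Real.exp (-(rho ^ 2 / 3 * M)) := by
  obtain ⟨K, hK, hKe⟩ := exp_mul_centre i
  have hr : rho = 1 / 10 ^ 6 := rfl
  set D := Real.exp (-(M * (2 * Real.log 2 * ∑ c, centre i c ^ 2))) with hD
  set z : Fin 3 → ℝ := fun b => 4 * Real.log 2 * centre i b + if b = c then -rho else 0 with hz
  have h1 : ∀ σ : Config M, linWeight (centre i) σ *
        Real.exp (M * (rho * (centre i c - rho - ratio σ c)))
      = Real.exp (M * ∑ b, ratio σ b * z b) * (D * Real.exp (M * (rho * (centre i c - rho)))) := by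
    intro σ
    have : ∑ b, ratio σ b * z b = ∑ b, ratio σ b * (4 * Real.log 2 * centre i b)
        - rho * ratio σ c := by
      simp only [hz, mul_add, Finset.sum_add_distrib]
      simp
      ring
    rw [this, linWeight, hD]
    simp only [← Real.exp_add]
    congr 1
    ring
  have h2 : ∑ b, Real.exp (z b) = K * (1 - centre i c * (1 - Real.exp (-rho))) := by
    have : ∀ b, Real.exp (z b) = K * (centre i b -
        if b = c then centre i b * (1 - Real.exp (-rho)) else 0) := by
      intro b
      rw [hz, Real.exp_add, hKe]
      split_ifs
      · ring
      · simp
    simp only [this]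
    rw [← Finset.mul_sum, Finset.sum_sub_distrib, sum_centre]
    simp
  have h3 : K ^ M * D = Real.exp (M * maxEnergy) := by
    rw [← dualEnergy_centre i, ← sum_linWeight hM]
    simp only [linWeight]
    rw [← Finset.sum_mul, sum_exp_linear hM, hD]
    simp only [hKe]
    rw [← Finset.mul_sum, sum_centre, mul_one]
  simp only [h1]
  rw [← Finset.sum_mul, sum_exp_linear hM, h2, mul_pow]
  have hc0 := centre_pos i c
  have hc1 : centre i c ≤ 2 / 3 := by
    fin_cases i <;> fin_cases c <;> simp [centre] <;> norm_num
  have he1 : Real.exp (-rho) ≤ 1 - rho + rho ^ 2 := by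
    have := (abs_le.1 (Real.abs_exp_sub_one_sub_id_le (x := -rho) (by rw [hr]; norm_num))).2
    linarith
  have he0 := Real.exp_pos (-rho)
  have h4 : (1 - centre i c * (1 - Real.exp (-rho))) ^ M
      ≤ Real.exp (M * (-(centre i c * (rho - rho ^ 2)))) := by
    rw [Real.exp_nat_mul]
    refine pow_le_pow_left₀ ?_ ?_ M
    · nlinarith
    · have := Real.add_one_le_exp (-(centre i c * (rho - rho ^ 2)))
      have := mul_le_mul_of_nonneg_left he1 hc0.le
      linarith
  calc K ^ M * (1 - centre i c * (1 - Real.exp (-rho))) ^ M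
        * (D * Real.exp (M * (rho * (centre i c - rho))))
      = (K ^ M * D) * ((1 - centre i c * (1 - Real.exp (-rho))) ^ M
        * Real.exp (M * (rho * (centre i c - rho)))) := by ring
    _ ≤ Real.exp (M * maxEnergy) * (Real.exp (M * (-(centre i c * (rho - rho ^ 2))))
        * Real.exp (M * (rho * (centre i c - rho)))) := by
        rw [h3]; gcongr
    _ ≤ _ := by
        refine mul_le_mul_of_nonneg_left ?_ (Real.exp_pos _).le
        rw [← Real.exp_add]
        refine Real.exp_le_exp.2 ?_
        -- The terms linear in `rho` cancel and the exponent is `-(1 - centre i c) * rho ^ 2 * M`;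
        -- the bound `centre i c ≤ 2/3` gives the rate `rho ^ 2 / 3`.
        have : centre i c * rho ^ 2 * M ≤ 2 / 3 * rho ^ 2 * M := by gcongr
        linarith

open scoped Classical in
-- After normalisation `linWeight (centre i)` makes the spins independent with law `centre i`,
-- because the centre solves the mean-field equation. By the Chernoff bound at least half of its
-- mass lies in the core once `rho ^ 2 * M` is large, and it is dominated by the Gibbs weight.
lemma half_exp_le_sum_core (hM : (10 : ℝ) ^ 14 ≤ M) (i : Fin 4) :
    1 / 2 * Real.exp (M * maxEnergy)
      ≤ ∑ σ, if σ ∈ core M i then weight criticalBeta σ else 0 := by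
  have hMn : M ≠ 0 := by rintro rfl; norm_num at hM
  have htot := sum_linWeight hMn (centre i)
  rw [dualEnergy_centre] at htot
  have hpos : ∀ (σ : Config M), 0 ≤ linWeight (centre i) σ := fun σ =>
    mul_nonneg (Real.exp_pos _).le (Real.exp_pos _).le
  have hr : rho = 1 / 10 ^ 6 := rfl
  have hsmall : 3 * Real.exp (-(rho ^ 2 / 3 * M)) ≤ 1 / 2 := by
    have h1 : (6 : ℝ) ≤ Real.exp (rho ^ 2 / 3 * M) := by
      have := Real.add_one_le_exp (rho ^ 2 / 3 * M)
      have h2 : (5 : ℝ) ≤ rho ^ 2 / 3 * M := by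
        have h3 : rho ^ 2 / 3 * 10 ^ 14 ≤ rho ^ 2 / 3 * M := by gcongr
        refine le_trans ?_ h3
        rw [hr]; norm_num
      linarith
    rw [Real.exp_neg]
    have := inv_anti₀ (by norm_num) h1
    linarith
  have key : ∀ σ : Config M, linWeight (centre i) σ
      ≤ (if σ ∈ core M i then weight criticalBeta σ else 0) +
        ∑ c, linWeight (centre i) σ * Real.exp (M * (rho * (centre i c - rho - ratio σ c))) := by
    intro σ
    have h0 : ∀ c ∈ (Finset.univ : Finset (Fin 3)), 0 ≤ linWeight (centre i) σ *
        Real.exp (M * (rho * (centre i c - rho - ratio σ c))) := fun c _ =>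
      mul_nonneg (hpos σ) (Real.exp_pos _).le
    split_ifs with h
    · exact (linWeight_le _ σ).trans (le_add_of_nonneg_right (Finset.sum_nonneg h0))
    · rw [zero_add]
      simp only [core, Set.mem_ofPred_eq, not_forall, not_le] at h
      obtain ⟨c, hc⟩ := h
      refine le_trans ?_ (Finset.single_le_sum h0 (Finset.mem_univ c))
      refine le_mul_of_one_le_right (hpos σ) (Real.one_le_exp ?_)
      have : 0 < rho := by rw [hr]; norm_num
      have : 0 < centre i c - rho - ratio σ c := by linarith
      positivity
  have hsum := Finset.sum_le_sum fun σ (_ : σ ∈ (Finset.univ : Finset (Config M))) => key σ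
  rw [htot, Finset.sum_add_distrib, Finset.sum_comm] at hsum
  have hch : ∑ c : Fin 3, ∑ σ : Config M, linWeight (centre i) σ *
      Real.exp (M * (rho * (centre i c - rho - ratio σ c)))
      ≤ Real.exp (M * maxEnergy) * (1 / 2) := by
    calc _ ≤ ∑ _c : Fin 3, Real.exp (M * maxEnergy) * Real.exp (-(rho ^ 2 / 3 * M)) :=
          Finset.sum_le_sum fun c _ => sum_linWeight_tilted_le hMn i c
      _ = Real.exp (M * maxEnergy) * (3 * Real.exp (-(rho ^ 2 / 3 * M))) := by
          simp; ring
      _ ≤ _ := mul_le_mul_of_nonneg_left hsmall (Real.exp_pos _).le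
  linarith

/-- The ratios of the configurations of a mode lie in this closed set. -/
def modeRegion : Fin 4 → Set (Fin 3 → ℝ) :=
  ![{y | 1 / 2 ≤ y 0}, {y | 1 / 2 ≤ y 1}, {y | 1 / 2 ≤ y 2}, {y | ∀ c, y c ≤ 1 / 2}]

lemma isClosed_modeRegion (i : Fin 4) : IsClosed (modeRegion i) := by
  have h : IsClosed {y : Fin 3 → ℝ | ∀ c, y c ≤ 1 / 2} := by
    simp only [Set.ofPred_forall]
    exact isClosed_iInter fun c => isClosed_le (continuous_apply c) continuous_const
  fin_cases i
  · exact isClosed_le continuous_const (continuous_apply 0)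
  · exact isClosed_le continuous_const (continuous_apply 1)
  · exact isClosed_le continuous_const (continuous_apply 2)
  · exact h

lemma ratio_mem_modeRegion {i : Fin 4} {σ : Config M} (h : σ ∈ mode M i) :
    ratio σ ∈ modeRegion i := by
  fin_cases i
  · exact (show 1 / 2 < ratio σ 0 from h).le
  · exact (show 1 / 2 < ratio σ 1 from h).le
  · exact (show 1 / 2 < ratio σ 2 from h).le
  · intro c
    simp [mode, majority] at h
    fin_cases c <;> simp <;> linarith [h.1.1, h.1.2, h.2]

lemma eq_of_centre_mem_modeRegion {i j : Fin 4} (h : centre j ∈ modeRegion i) : j = i := by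
  fin_cases i <;> fin_cases j <;> simp [centre, modeRegion, Fin.forall_fin_succ] at h ⊢ <;>
    norm_num at h

lemma mem_mode_of_abs_sub_le {i : Fin 4} {σ : Config M}
    (h : ∀ c, |ratio σ c - centre i c| ≤ 3 * rho) : σ ∈ mode M i := by
  have hr : rho = 1 / 10 ^ 6 := rfl
  have h0 := abs_le.1 (h 0)
  have h1 := abs_le.1 (h 1)
  have h2 := abs_le.1 (h 2)
  rw [hr] at h0 h1 h2
  fin_cases i <;> simp [centre] at h0 h1 h2 <;> simp [mode, majority]
  · linarith
  · linarith
  · linarith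
  · refine ⟨⟨?_, ?_⟩, ?_⟩ <;> linarith

lemma core_subset_mode (hM : (10 : ℝ) ^ 9 ≤ M) {i : Fin 4} {σ : Config M} (h : σ ∈ core M i) :
    σ ∈ mode M i ∧ ∀ v c, Function.update σ v c ∈ mode M i := by
  have h1M := one_div_le_of_le hM
  have h1M0 : 0 ≤ 1 / (M : ℝ) := by positivity
  have hr : rho = 1 / 10 ^ 6 := rfl
  have hu := ratio_le_of_mem_core (ne_zero_of_le hM) h
  constructor
  · refine mem_mode_of_abs_sub_le fun c => abs_le.2 ?_
    constructor <;> linarith [h c, hu c]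
  · intro v b
    refine mem_mode_of_abs_sub_le fun c => abs_le.2 ?_
    have := othersRatio_bounds σ v c
    rw [ratio_update]
    split_ifs <;> constructor <;> linarith [h c, hu c]

/-- Outside the core, the free energy of a mode is bounded away from its maximum. -/
lemma exists_energy_gap (i : Fin 4) : ∃ m, m < maxEnergy ∧ ∀ (M : ℕ) (σ : Config M), M ≠ 0 →
    σ ∈ mode M i → σ ∉ core M i → dualEnergy (ratio σ) ≤ m := by
  set K : Set (Fin 3 → ℝ) := (Set.Icc 0 1 ∩ {y | ∑ c, y c = 1}) ∩
    (modeRegion i ∩ ⋃ c, {y | y c ≤ centre i c - rho}) with hK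
  have hcomp : IsCompact K := by
    refine (isCompact_Icc.inter_right ?_).inter_right ((isClosed_modeRegion i).inter ?_)
    · exact isClosed_eq (by fun_prop) continuous_const
    · exact isClosed_iUnion_of_finite fun c => isClosed_le (continuous_apply c) continuous_const
  have hmem : ∀ (M : ℕ) (σ : Config M), M ≠ 0 → σ ∈ mode M i → σ ∉ core M i → ratio σ ∈ K := by
    intro M σ hM hm hc
    simp only [core, Set.mem_ofPred_eq, not_forall, not_le] at hc
    obtain ⟨c, hc⟩ := hc
    refine ⟨⟨⟨fun c => ratio_nonneg σ c, fun c => ?_⟩, sum_ratio hM σ⟩,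
      ratio_mem_modeRegion hm, Set.mem_iUnion.2 ⟨c, hc.le⟩⟩
    have := Finset.single_le_sum (f := ratio σ) (fun b _ => ratio_nonneg σ b) (Finset.mem_univ c)
    rwa [sum_ratio hM] at this
  rcases K.eq_empty_or_nonempty with he | hne
  · refine ⟨maxEnergy - 1, by linarith, fun M σ hM hm hc => ?_⟩
    have := hmem M σ hM hm hc
    rw [he] at this
    exact this.elim
  · obtain ⟨y, hy, hmax⟩ := hcomp.exists_isMaxOn hne continuous_dualEnergy.continuousOn
    refine ⟨dualEnergy y, dualEnergy_lt hy.1.2 ?_, fun M σ hM hm hc => hmax (hmem M σ hM hm hc)⟩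
    -- A maximiser on `K` cannot be a centre: the closed region of a mode contains no other centre
    -- than its own, and that one violates the core condition.
    rintro j rfl
    obtain rfl := eq_of_centre_mem_modeRegion hy.2.1
    obtain ⟨c, hc⟩ := Set.mem_iUnion.1 hy.2.2
    have hc : centre j c ≤ centre j c - rho := hc
    have : 0 < rho := by norm_num [rho]
    linarith

open scoped Classical in
/-- Concentration of a mode of the Gibbs measure on its core. -/
lemma exists_concentration (i : Fin 4) : ∃ g : ℝ, 0 < g ∧ ∀ M : ℕ, (10 : ℝ) ^ 14 ≤ M →
    0 < ∑ σ, (if σ ∈ mode M i then gibbs criticalBeta M σ else 0) ∧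
    ∑ σ, (if σ ∈ mode M i \ core M i then gibbs criticalBeta M σ else 0)
      ≤ 2 * ((M : ℝ) + 1) ^ 3 * Real.exp (-(g * M)) *
        ∑ σ, (if σ ∈ mode M i then gibbs criticalBeta M σ else 0) := by
  obtain ⟨m, hm, hgap⟩ := exists_energy_gap i
  refine ⟨maxEnergy - m, by linarith, fun M hM => ?_⟩
  have hM9 : (10 : ℝ) ^ 9 ≤ M := le_trans (by norm_num) hM
  have hMn := ne_zero_of_le hM9
  have hZ := sum_weight_pos criticalBeta M
  have hg : ∀ S : Set (Config M), ∑ σ, (if σ ∈ S then gibbs criticalBeta M σ else 0)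
      = (∑ σ, if σ ∈ S then weight criticalBeta σ else 0) / ∑ τ : Config M, weight criticalBeta τ := by
    intro S
    rw [Finset.sum_div]
    refine Finset.sum_congr rfl fun σ _ => ?_
    split_ifs <;> simp [gibbs]
  have hlow := half_exp_le_sum_core hM i
  have hsub : ∑ σ, (if σ ∈ core M i then weight criticalBeta σ else 0)
      ≤ ∑ σ, if σ ∈ mode M i then weight criticalBeta σ else 0 := by
    refine Finset.sum_le_sum fun σ _ => ?_
    have hw : 0 ≤ weight criticalBeta σ := (Real.exp_pos _).le
    by_cases h : σ ∈ core M i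
    · simp [h, (core_subset_mode hM9 h).1]
    · simp only [h, if_false]; split_ifs <;> simp [hw]
  have hup := sum_weight_le hMn (mode M i \ core M i) fun σ hσ => hgap M σ hMn hσ.1 hσ.2
  have he := Real.exp_pos (M * maxEnergy)
  have hg' : ∑ σ, (if σ ∈ mode M i \ core M i then gibbs criticalBeta M σ else 0)
      = (∑ σ, if σ ∈ mode M i \ core M i then weight criticalBeta σ else 0)
        / ∑ τ : Config M, weight criticalBeta τ := by
    convert hg (mode M i \ core M i)
  rw [hg, hg']
  constructor
  · exact div_pos (by linarith) hZ
  · rw [← mul_div_assoc]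
    refine div_le_div_of_nonneg_right ?_ hZ.le
    refine le_trans (le_of_eq ?_) (hup.trans ?_)
    · congr!
    have e : Real.exp (M * m) = Real.exp (-((maxEnergy - m) * M)) * Real.exp (M * maxEnergy) := by
      rw [← Real.exp_add]; congr 1; ring
    rw [e]
    calc ((M : ℝ) + 1) ^ 3 * (Real.exp (-((maxEnergy - m) * M)) * Real.exp (M * maxEnergy))
        = 2 * ((M : ℝ) + 1) ^ 3 * Real.exp (-((maxEnergy - m) * M))
          * (1 / 2 * Real.exp (M * maxEnergy)) := by ring
      _ ≤ _ := mul_le_mul_of_nonneg_left (hlow.trans hsub) (by positivity)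

/-! ### Mixing within a mode and choice of the constants -/

lemma sum_glauber_pow_mul (k : ℕ) (σ : Config M) (f : Config M → ℝ) :
    ∑ x, (glauber (gibbs criticalBeta M) ^ k) σ x * f x
      = (resample (condProb (gibbs criticalBeta M)))^[k] f σ := by
  have : ((glauber (gibbs criticalBeta M) ^ k).mulVec f)
      = (resample (condProb (gibbs criticalBeta M)))^[k] f := by
    induction k with
    | zero => simp
    | succ k ih =>
      rw [pow_succ', ← Matrix.mulVec_mulVec, ih, glauber_mulVec, Function.iterate_succ_apply']
  exact congrFun this σ

lemma dTV_le {α : Type*} [Fintype α] {p q : α → ℝ} {B : ℝ}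
    (h : ∀ f : α → ℝ, (∀ x, |f x| ≤ 1) → |∑ x, p x * f x - ∑ x, q x * f x| ≤ 2 * B) :
    dTV p q ≤ B := by
  have : Nonempty {f : α → ℝ // ∀ x, f x ∈ Set.Icc (-1 : ℝ) 1} :=
    ⟨⟨fun _ => 0, fun _ => by norm_num⟩⟩
  have := ciSup_le fun f : {f : α → ℝ // ∀ x, f x ∈ Set.Icc (-1 : ℝ) 1} =>
    h f.1 fun x => abs_le.2 (f.2 x)
  rw [dTV]
  linarith

lemma mul_one_sub_pow_le (hM : (10 : ℝ) ^ 9 ≤ M) {k : ℕ}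
    (hk : 330 * (M : ℝ) * Real.log M ≤ k) :
    2 * (M : ℝ) * (1 - 7 / 100 / M) ^ k ≤ 2 / (M : ℝ) ^ 2 := by
  have hM0 : (0 : ℝ) < M := by linarith [(by norm_num : (0 : ℝ) < 10 ^ 9)]
  have hM1 : (1 : ℝ) ≤ M := by linarith [(by norm_num : (1 : ℝ) < 10 ^ 9)]
  have hlog : 0 ≤ Real.log M := Real.log_nonneg hM1
  have h1M := one_div_le_of_le hM
  have h1 : (1 - 7 / 100 / (M : ℝ)) ^ k ≤ Real.exp (-(3 * Real.log M)) := by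
    have e : Real.exp (-(7 / 100 / (M : ℝ)) * k) = Real.exp (-(7 / 100 / (M : ℝ))) ^ k := by
      rw [mul_comm, Real.exp_nat_mul]
    calc (1 - 7 / 100 / (M : ℝ)) ^ k ≤ Real.exp (-(7 / 100 / (M : ℝ))) ^ k := by
          refine pow_le_pow_left₀ ?_ (Real.one_sub_le_exp_neg _) k
          rw [div_eq_mul_one_div]
          linarith
      _ ≤ _ := by
          rw [← e]
          refine Real.exp_le_exp.2 ?_
          have h2 : 7 / 100 / (M : ℝ) * (330 * M * Real.log M) ≤ 7 / 100 / (M : ℝ) * k := by gcongr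
          -- The contraction yields the exponent `23.1 * log M`; only `3 * log M` is needed, one
          -- power of `M` being spent on the diameter of the configuration space.
          have h3 : 7 / 100 / (M : ℝ) * (330 * M * Real.log M) = 23.1 * Real.log M := by
            field_simp; ring
          linarith
  have h2 : Real.exp (-(3 * Real.log M)) = 1 / (M : ℝ) ^ 3 := by
    rw [Real.exp_neg, show 3 * Real.log (M : ℝ) = (3 : ℕ) * Real.log M by norm_num,
      Real.exp_nat_mul, Real.exp_log hM0, one_div]
  rw [h2] at h1
  calc 2 * (M : ℝ) * (1 - 7 / 100 / M) ^ k ≤ 2 * M * (1 / (M : ℝ) ^ 3) := by gcongr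
    _ = _ := by field_simp

open scoped Classical in
/-- Mixing within a mode, tested on a bounded function. -/
lemma abs_sum_glauber_pow_sub_le {i : Fin 4} {g : ℝ} (hM : (10 : ℝ) ^ 9 ≤ M)
    (hpos : 0 < ∑ σ, (if σ ∈ mode M i then gibbs criticalBeta M σ else 0))
    (hconc : ∑ σ, (if σ ∈ mode M i \ core M i then gibbs criticalBeta M σ else 0)
      ≤ 2 * ((M : ℝ) + 1) ^ 3 * Real.exp (-(g * M)) *
        ∑ σ, (if σ ∈ mode M i then gibbs criticalBeta M σ else 0))
    {k : ℕ} (hk : 330 * (M : ℝ) * Real.log M ≤ k) {σ : Config M} (hσ : σ ∈ innerRegion M i)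
    {f : Config M → ℝ} (hf : ∀ τ, |f τ| ≤ 1) :
    |∑ x, (glauber (gibbs criticalBeta M) ^ k) σ x * f x
        - ∑ x, restrictTo (gibbs criticalBeta M) (mode M i) x * f x|
      ≤ 2 / (M : ℝ) ^ 2 + (6 + 12 * k) * Real.exp (-(exitRate * M))
        + 8 * k * ((M : ℝ) + 1) ^ 3 * Real.exp (-(g * M)) := by
  have hMn := ne_zero_of_le hM
  set Z := ∑ σ, (if σ ∈ mode M i then gibbs criticalBeta M σ else 0) with hZ
  set Q := (resample (clippedProb i))^[k] f with hQ
  have h1 : |(resample (condProb (gibbs criticalBeta M)))^[k] f σ - Q σ|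
      ≤ (6 + 12 * k) * Real.exp (-(exitRate * M)) := by
    refine (abs_iterate_sub_iterate_le hM i hf k σ).trans ?_
    have := sum_lyap_le hσ
    linarith
  have hν : ∀ h : Config M → ℝ, ∑ x, restrictTo (gibbs criticalBeta M) (mode M i) x * h x
      = (∑ x, (if x ∈ mode M i then gibbs criticalBeta M x else 0) * h x) / Z := by
    intro h
    rw [Finset.sum_div]
    exact Finset.sum_congr rfl fun x _ => by rw [restrictTo]; ring
  have h3 : |∑ x, restrictTo (gibbs criticalBeta M) (mode M i) x * Q x
      - ∑ x, restrictTo (gibbs criticalBeta M) (mode M i) x * f x|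
      ≤ 8 * k * ((M : ℝ) + 1) ^ 3 * Real.exp (-(g * M)) := by
    rw [hν, hν, ← sub_div, abs_div, abs_of_pos hpos, div_le_iff₀ hpos]
    refine (abs_sum_mul_iterate_clipped_sub_le hM (fun τ hτ => core_subset_mode hM hτ) hf k).trans ?_
    have := mul_le_mul_of_nonneg_left hconc (by positivity : (0 : ℝ) ≤ 4 * k)
    linarith
  have h2 : |Q σ - ∑ x, restrictTo (gibbs criticalBeta M) (mode M i) x * Q x|
      ≤ 2 / (M : ℝ) ^ 2 := by
    have e : Q σ = (∑ x, (if x ∈ mode M i then gibbs criticalBeta M x else 0) * Q σ) / Z := by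
      rw [← Finset.sum_mul, ← hZ, mul_div_cancel_left₀ _ hpos.ne']
    rw [hν, e, ← sub_div, abs_div, abs_of_pos hpos, div_le_iff₀ hpos, ← Finset.sum_sub_distrib, hZ,
      Finset.mul_sum]
    refine (Finset.abs_sum_le_sum_abs _ _).trans (Finset.sum_le_sum fun x _ => ?_)
    have hx : 0 ≤ (if x ∈ mode M i then gibbs criticalBeta M x else 0) := by
      split_ifs
      · exact (gibbs_pos M x).le
      · exact le_rfl
    rw [← mul_sub, abs_mul, abs_of_nonneg hx, mul_comm]
    refine mul_le_mul_of_nonneg_right ?_ hx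
    exact (abs_iterate_resample_sub_le hM i hf k x σ).trans (mul_one_sub_pow_le hM hk)
  rw [sum_glauber_pow_mul]
  rw [abs_le] at *
  constructor <;> linarith [h1.1, h1.2, h2.1, h2.2, h3.1, h3.2]

/-- Taking `C` at most half of both rates leaves a factor `exp (C * M)` to absorb the cubic
polynomial; `41 = 9 + 4 * 8` comes from `M + 1 ≤ 2 * M`. -/
lemma eventually_exp_bound {g C : ℝ} (hC : 0 < C) (hCη : 2 * C ≤ exitRate) (hCg : 2 * C ≤ g) :
    ∀ᶠ M : ℕ in Filter.atTop, 9 * Real.exp (-(exitRate * M))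
      + 4 * ((M : ℝ) + 1) ^ 3 * Real.exp (-(g * M)) ≤ 3 * Real.exp (-C * M) := by
  have h := ((isLittleO_pow_exp_pos_mul_atTop 3 hC).comp_tendsto
    tendsto_natCast_atTop_atTop).bound (show (0 : ℝ) < 1 / 41 by norm_num)
  filter_upwards [h, Filter.eventually_ge_atTop 1] with M h1 hM
  have hM1 : (1 : ℝ) ≤ M := by exact_mod_cast hM
  simp only [Function.comp_apply, Real.norm_eq_abs, Real.abs_exp] at h1
  rw [abs_of_nonneg (by positivity)] at h1
  have e1 : Real.exp (-(exitRate * M)) ≤ Real.exp (-(2 * C * M)) :=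
    Real.exp_le_exp.2 (by nlinarith)
  have e2 : Real.exp (-(g * M)) ≤ Real.exp (-(2 * C * M)) :=
    Real.exp_le_exp.2 (by nlinarith)
  have e3 : Real.exp (-(2 * C * M)) * Real.exp (C * M) = Real.exp (-C * M) := by
    rw [← Real.exp_add]; congr 1; ring
  have e4 : 9 + 4 * ((M : ℝ) + 1) ^ 3 ≤ 41 * (M : ℝ) ^ 3 := by
    have h2 : ((M : ℝ) + 1) ^ 3 ≤ (2 * M) ^ 3 := by gcongr; linarith
    have h3 : (1 : ℝ) ≤ (M : ℝ) ^ 3 := one_le_pow₀ hM1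
    linarith
  have hE := Real.exp_pos (-(2 * C * M))
  calc 9 * Real.exp (-(exitRate * M)) + 4 * ((M : ℝ) + 1) ^ 3 * Real.exp (-(g * M))
      ≤ 9 * Real.exp (-(2 * C * M)) + 4 * ((M : ℝ) + 1) ^ 3 * Real.exp (-(2 * C * M)) := by gcongr
    _ = Real.exp (-(2 * C * M)) * (9 + 4 * ((M : ℝ) + 1) ^ 3) := by ring
    _ ≤ Real.exp (-(2 * C * M)) * Real.exp (C * M) := by
        refine mul_le_mul_of_nonneg_left ?_ hE.le
        linarith
    _ ≤ _ := by rw [e3]; linarith [Real.exp_pos (-C * M)]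

end MeanFieldPotts

end

theorem mainTheorem8 :
    ∃ C : ℝ, 0 < C ∧ ∃ C' : ℝ, 0 < C' ∧ ∃ M₀ : ℕ, ∀ M : ℕ, M₀ ≤ M →
      ∀ k : ℕ, 330 * (M : ℝ) * Real.log (M : ℝ) ≤ (k : ℝ) →
        ∀ (i : Fin 4) (σ : MeanFieldPotts.Config M), σ ∈ MeanFieldPotts.innerRegion M i →
          MeanFieldPotts.dTV
              ((MeanFieldPotts.glauber
                (MeanFieldPotts.gibbs MeanFieldPotts.criticalBeta M) ^ k) σ)
              (MeanFieldPotts.restrictTo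
                (MeanFieldPotts.gibbs MeanFieldPotts.criticalBeta M) (MeanFieldPotts.mode M i))
            ≤ C / (M : ℝ) ^ 2 + 3 * (k : ℝ) ^ 2 * Real.exp (-C' * (M : ℝ)) := by
  choose g hg hconc using MeanFieldPotts.exists_concentration
  have hη := MeanFieldPotts.exitRate_pos
  obtain ⟨C', hC', hC'η, hC'g⟩ : ∃ C' : ℝ, 0 < C' ∧ 2 * C' ≤ MeanFieldPotts.exitRate ∧
      ∀ i, 2 * C' ≤ g i := by
    obtain ⟨j, hj⟩ := Finite.exists_min g
    refine ⟨min MeanFieldPotts.exitRate (g j) / 2, by have := lt_min hη (hg j); linarith, ?_, ?_⟩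
    · linarith [min_le_left MeanFieldPotts.exitRate (g j)]
    · intro i
      linarith [min_le_right MeanFieldPotts.exitRate (g j), hj i]
  obtain ⟨M₁, hM₁⟩ := Filter.eventually_atTop.1 (Filter.eventually_all.2 fun i =>
    MeanFieldPotts.eventually_exp_bound hC' hC'η (hC'g i))
  -- The constant `1` is half of the `2` in the bound `2 / M ^ 2` for test functions, by the factor
  -- `1/2` in `dTV`. The threshold `10 ^ 14` is about `100 / rho ^ 2`, as the Chernoff bound
  -- requires.
  refine ⟨1, one_pos, C', hC', max M₁ (10 ^ 14), fun M hM k hk i σ hσ => ?_⟩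
  have hM14 : (10 : ℝ) ^ 14 ≤ M := by exact_mod_cast (le_max_right _ _).trans hM
  have hM9 : (10 : ℝ) ^ 9 ≤ M := le_trans (by norm_num) hM14
  have hexp := hM₁ M ((le_max_left _ _).trans hM) i
  have hk1 : (1 : ℝ) ≤ k := by
    have hM1 : (1 : ℝ) < M := lt_of_lt_of_le (by norm_num) hM9
    have hk0 : (0 : ℝ) < k := lt_of_lt_of_le
      (mul_pos (by linarith) (Real.log_pos hM1)) hk
    exact_mod_cast hk0
  have hkk : (k : ℝ) ≤ (k : ℝ) ^ 2 := by nlinarith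
  refine MeanFieldPotts.dTV_le fun f hf =>
    (MeanFieldPotts.abs_sum_glauber_pow_sub_le hM9 (hconc i M hM14).1
      (hconc i M hM14).2 hk hσ hf).trans ?_
  have hE1 := Real.exp_pos (-(MeanFieldPotts.exitRate * M))
  have hE2 : 0 < ((M : ℝ) + 1) ^ 3 * Real.exp (-(g i * M)) :=
    mul_pos (by positivity) (Real.exp_pos _)
  have h1 : (3 + 6 * (k : ℝ)) * Real.exp (-(MeanFieldPotts.exitRate * M))
      ≤ (k : ℝ) ^ 2 * (9 * Real.exp (-(MeanFieldPotts.exitRate * M))) := by nlinarith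
  have h2 : 4 * (k : ℝ) * (((M : ℝ) + 1) ^ 3 * Real.exp (-(g i * M)))
      ≤ (k : ℝ) ^ 2 * (4 * (((M : ℝ) + 1) ^ 3 * Real.exp (-(g i * M)))) := by nlinarith
  have h3 := mul_le_mul_of_nonneg_left hexp (sq_nonneg (k : ℝ))
  have h4 : 2 / (M : ℝ) ^ 2 = 2 * (1 / (M : ℝ) ^ 2) := by ring
  rw [h4]
  linarith
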